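/- Let $\Bbbk$ be an algebraically closed field of characteristic zero and let $H$ be a finite-dimensional Hopf algebra over $\Bbbk$, with group of grouplike elements $G(H)$. Its coradical $H_0$ is the sum of its simple subcoalgebras. Assume that $H$ is not cosemisimple ($H\neq H_0$) and has no nontrivial skew-primitives: for $g,h\in G(H)$, every $x\in H$ with $\Delta(x)=g\otimes x+x\otimes h$ lies in $\Bbbk(h-g)$. Let $\pi:H\to H_0$ be any coalgebra projection onto the coradical (a coalgebra map that is the identity on $H_0$), put $\rho_L=(\pi\otimes\mathrm{id})\Delta$, $\rho_R=(\mathrm{id}\otimes\pi)\Delta$, and define $P_0=0$ and, for $n\ge 1$, $$P_n=\Big\{x\in H:\ \Delta(x)-\rho_L(x)-\rho_R(x)\in\sum_{1\le i\le n-1}P_i\otimes P_{n-i}\Big\}.$$ Each $P_n$ is an $H_0$-bicomodule via $\rho_L$ and $\rho_R$. For simple subcoalgebras $C,D$ let $P_n^{C,D}$ be the isotypic component of $P_n$ of type the simple bicomodule with coalgebra of coefficients $C\otimes D$ (left coefficients in $C$, right coefficients in $D$); for a grouplike $g$ write $g$ in place of $\Bbbk g$ in the superscripts. For $n\ge1$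 call $P_n^{C,D}$ nondegenerate if $P_n^{C,D}\not\subseteq P_{n-1}$. (i) For every $g\in G(H)$ there is a simple subcoalgebra $C$ of $H$ with $\dim C>1$ such that $P_1^{C,g}\neq0$; $P_k^{C,D}$ is nondegenerate for some $k>1$ and some simple subcoalgebra $D$ with $\dim D=\dim C$; and $P_m^{g,h}$ is nondegenerate for some $m>1$ and some $h\in G(H)$. (ii) Suppose that, as a coalgebra, $H_0\cong\Bbbk G\oplus\mathcal M^*(n,\Bbbk)\oplus\bigoplus_{i=1}^t\mathcal M^*(n_i,\Bbbk)$, where $G$ is a group, $t\ge0$, $2\le n\le n_1\le\dots\le n_t$, and $\mathcal M^*(r,\Bbbk)$ denotes the $r^2$-dimensional comatrix coalgebra dual to the algebra of $r\times r$ matrices. Then $$\dim H\ \ge\ \dim H_0+(2n+1)\,|G|+n^2 .$$ -/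

import Mathlib

open scoped TensorProduct

namespace HopfCoradical

/-! ### The comatrix coalgebra -/

/-- The `n × n` comatrix coalgebra over `k`: the dual of the matrix algebra `M_n(k)`, that is, the
`n²`-dimensional space with basis `e i j`, comultiplication `Δ (e i j) = ∑ l, e i l ⊗ e l j` and
counit `ε (e i j) = δ_{ij}`. The underlying space is identified with matrices. -/
def Comatrix (k : Type*) (n : ℕ) : Type _ := Matrix (Fin n) (Fin n) k

namespace Comatrix

variable {k : Type*} [Field k] {n : ℕ}

instance : AddCommGroup (Comatrix k n) :=
  inferInstanceAs (AddCommGroup (Matrix (Fin n) (Fin n) k))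

instance : Module k (Comatrix k n) :=
  inferInstanceAs (Module k (Matrix (Fin n) (Fin n) k))

variable (k n) in
/-- The basis `e i j`, indexed by the pairs `(i, j)`. -/
noncomputable def basis : Module.Basis (Fin n × Fin n) k (Comatrix k n) :=
  Matrix.stdBasis k (Fin n) (Fin n)

/-- The matrix coefficient `e i j`. -/
noncomputable def e (i j : Fin n) : Comatrix k n := basis k n (i, j)

noncomputable instance : CoalgebraStruct k (Comatrix k n) where
  comul := (basis k n).constr k fun p => ∑ l, e p.1 l ⊗ₜ[k] e l p.2
  counit := (basis k n).constr k fun p => if p.1 = p.2 then 1 else 0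

theorem comul_e (i j : Fin n) :
    Coalgebra.comul (R := k) (e i j : Comatrix k n) = ∑ l, e i l ⊗ₜ[k] e l j :=
  (basis k n).constr_basis k _ (i, j)

theorem counit_e (i j : Fin n) :
    Coalgebra.counit (R := k) (e i j : Comatrix k n) = if i = j then 1 else 0 :=
  (basis k n).constr_basis k _ (i, j)

noncomputable instance : Coalgebra k (Comatrix k n) where
  coassoc := by
    refine (basis k n).ext fun p => ?_
    obtain ⟨i, j⟩ := p
    change _ = (LinearMap.lTensor _ Coalgebra.comul) (Coalgebra.comul (e i j))
    change (TensorProduct.assoc k _ _ _)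
      ((LinearMap.rTensor _ Coalgebra.comul) (Coalgebra.comul (e i j))) = _
    simp only [comul_e, map_sum, LinearMap.rTensor_tmul, LinearMap.lTensor_tmul,
      TensorProduct.sum_tmul, TensorProduct.tmul_sum, TensorProduct.assoc_tmul]
    rw [Finset.sum_comm]
  rTensor_counit_comp_comul := by
    refine (basis k n).ext fun p => ?_
    obtain ⟨i, j⟩ := p
    change (LinearMap.rTensor _ Coalgebra.counit) (Coalgebra.comul (e i j)) =
      (1 : k) ⊗ₜ[k] (e i j : Comatrix k n)
    simp [comul_e, counit_e, TensorProduct.ite_tmul]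
  lTensor_counit_comp_comul := by
    refine (basis k n).ext fun p => ?_
    obtain ⟨i, j⟩ := p
    change (LinearMap.lTensor _ Coalgebra.counit) (Coalgebra.comul (e i j)) =
      (e i j : Comatrix k n) ⊗ₜ[k] (1 : k)
    simp [comul_e, counit_e, TensorProduct.tmul_ite]

end Comatrix

/-! ### Subcoalgebras and the coradical -/

section Coradical

variable {k D : Type*} [Field k] [AddCommGroup D] [Module k D] [Coalgebra k D]

/-- The subspace `A ⊗ B` of `D ⊗ D`. -/
noncomputable def tens (A B : Submodule k D) : Submodule k (D ⊗[k] D) :=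
  LinearMap.range (TensorProduct.mapIncl A B)

/-- `C` is a subcoalgebra of `D`: `Δ(C) ⊆ C ⊗ C`. -/
def IsSubcoalgebra (C : Submodule k D) : Prop :=
  C.map Coalgebra.comul ≤ tens C C

/-- `C` is a simple subcoalgebra of `D`: it is nonzero and its only subcoalgebras are `0`
and `C`. -/
def IsSimpleSubcoalgebra (C : Submodule k D) : Prop :=
  IsSubcoalgebra C ∧ C ≠ ⊥ ∧ ∀ B : Submodule k D, IsSubcoalgebra B → B ≤ C → B = ⊥ ∨ B = C

variable (k D) in
/-- The coradical `D₀`: the sum of all simple subcoalgebras of `D`. -/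
def coradical : Submodule k D :=
  sSup {C | IsSimpleSubcoalgebra C}

variable (k D) in
/-- `D` is cosemisimple: it equals its coradical. -/
def IsCosemisimple : Prop := coradical k D = ⊤

variable (k D) in
/-- For all grouplikes `g`, `h`, every `x` with `Δ(x) = g ⊗ x + x ⊗ h` is trivial,
i.e. lies in `k (h - g)`. -/
def NoNontrivialSkewPrimitives : Prop :=
  ∀ g h x : D, IsGroupLikeElem k g → IsGroupLikeElem k h →
    Coalgebra.comul (R := k) x = g ⊗ₜ[k] x + x ⊗ₜ[k] h → x ∈ Submodule.span k {h - g}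

/-! ### The subspaces `P_n` and their isotypic components -/

/-- A coalgebra projection of `D` onto its coradical, regarded as a coalgebra endomorphism `π`
of `D` whose image is `D₀` and which is the identity on `D₀`. Its kernel is the coideal `I`. -/
structure IsCoradicalProjection (π : D →ₗc[k] D) : Prop where
  range_eq : LinearMap.range (π : D →ₗ[k] D) = coradical k D
  apply_eq : ∀ x ∈ coradical k D, π x = x

/-- `ρ_L = (π ⊗ id) Δ`. -/
noncomputable def rhoL (π : D →ₗc[k] D) : D →ₗ[k] D ⊗[k] D :=
  LinearMap.rTensor D (π : D →ₗ[k] D) ∘ₗ Coalgebra.comul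

/-- `ρ_R = (id ⊗ π) Δ`. -/
noncomputable def rhoR (π : D →ₗc[k] D) : D →ₗ[k] D ⊗[k] D :=
  LinearMap.lTensor D (π : D →ₗ[k] D) ∘ₗ Coalgebra.comul

/-- The subspaces `P_n`: `P_0 = 0` and, for `n ≥ 1`,
`P_n = {x | Δ(x) - ρ_L(x) - ρ_R(x) ∈ ∑_{1 ≤ i ≤ n - 1} P_i ⊗ P_{n - i}}`.
For `n = 1` the sum is zero, so that `P_1 = {x | Δ(x) = ρ_L(x) + ρ_R(x)}`. In the code, `n` is
replaced by `n + 1` and `i` by `i + 1`. -/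
noncomputable def P (π : D →ₗc[k] D) : ℕ → Submodule k D
  | 0 => ⊥
  | n + 1 => (⨆ i : Fin n, tens (P π (i + 1)) (P π (n - i))).comap
      (Coalgebra.comul - rhoL π - rhoR π)

/-- `ρ_L(S) ⊆ A ⊗ S` and `ρ_R(S) ⊆ S ⊗ B`. -/
def HasCoefficients (π : D →ₗc[k] D) (A B S : Submodule k D) : Prop :=
  S.map (rhoL π) ≤ tens A S ∧ S.map (rhoR π) ≤ tens S B

/-- `S` is a sub-bicomodule of the `D₀`-bicomodule `D` (with coactions `ρ_L`, `ρ_R`). -/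
def IsSubBicomodule (π : D →ₗc[k] D) (S : Submodule k D) : Prop :=
  HasCoefficients π (coradical k D) (coradical k D) S

/-- `S` is a simple `D₀`-sub-bicomodule of `D`. -/
def IsSimpleSubBicomodule (π : D →ₗc[k] D) (S : Submodule k D) : Prop :=
  IsSubBicomodule π S ∧ S ≠ ⊥ ∧
    ∀ T : Submodule k D, IsSubBicomodule π T → T ≤ S → T = ⊥ ∨ T = S

/-- `P_n^{A,B}` for simple subcoalgebras `A` and `B`: the isotypic component of the
`D₀`-bicomodule `P_n` of type the simple bicomodule with coalgebra of coefficients `A ⊗ B`, i.e.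
the sum of the simple sub-bicomodules of `P_n` whose left coefficients lie in `A` and whose right
coefficients lie in `B` (as `A` and `B` are simple, the coefficients of a nonzero comodule then
span `A`, respectively `B`). -/
noncomputable def isotypicP (π : D →ₗc[k] D) (n : ℕ) (A B : Submodule k D) : Submodule k D :=
  sSup {S | S ≤ P π n ∧ IsSimpleSubBicomodule π S ∧ HasCoefficients π A B S}

/-- `P_n^{A,B}` is nondegenerate (for `n ≥ 1`): it is not contained in `P_{n-1}`. -/
def IsNondegenerateP (π : D →ₗc[k] D) (n : ℕ) (A B : Submodule k D) : Prop :=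
  ¬ isotypicP π n A B ≤ P π (n - 1)

end Coradical

end HopfCoradical

/-! The argument takes place in the dual algebra `A = H*`, realised as `WithConv (H →ₗ[k] k)` with
the convolution product. Wedderburn's theorem gives a surjection `φ` of `A` onto a product of matrix
algebras whose kernel `J = rad φ` is nilpotent. Blocks give simple subcoalgebras, blocks of size one
are the grouplikes, the coradical is the annihilator of `J` (`coradical_eq_perp_rad`), and `P_n` is
the part of `ker π` annihilated by `J ^ (n + 1)` (`IsCoradicalProjection.mem_P_iff`). So `P_n^{C,D}`
is nondegenerate as soon as the `(C, D)` block of `J ^ n / J ^ (n + 1)` is nonzero, i.e. `Link φ n C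
D` holds (`Link.isNondegenerateP`).

Three facts about `A` produce links. It is a Frobenius algebra, by evaluation at a left integral of
`H` (`exists_frobenius_form`), and the Nakayama automorphism then forces the top and the socle of a
projective `e A` to lie in blocks of equal size (`size_eq_of_socle`). If `J ≠ 0`, no block of size
one is projective: it would give, after translation by a grouplike, a normalised integral of `A`,
and Maschke's theorem would kill `J` (`exists_rad_mul_ne_zero`). Finally, without nontrivial
skew-primitives `J / J ^ 2` has no block between two grouplikes
(`not_link_of_noNontrivialSkewPrimitives`).

For (i), `J e_g ≠ 0` gives a block `(C, g)` in `J / J ^ 2`, and `C` has size greater than one. The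
socle of `e_C A` lies in blocks of the size of `C`; were it reached in degree one, it would meet
`g`, which has the wrong size. The socle of `e_g A` lies in blocks of size one, hence in degree
greater than one (`links_of_frobenius`).

For (ii), `dim H = dim H₀ + dim J / J ^ 2 + dim J ^ 2`. For each `g` the blocks `(C, g)` and `(g,
C')` of `J / J ^ 2` contribute at least `n` dimensions each. In `J ^ 2` each pair `(g, h)`
contributes one dimension, and a single pair `(C, D)` contributes `n ^ 2` (`finrank_ge_of_links`).
-/

open scoped TensorProduct

namespace HopfCoradical

/-! ### Powers of the radical and links between blocks -/

section Radical

variable {k A : Type*} [Field k] [Ring A] [Algebra k A]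
variable {ι : Type*} {d : ι → ℕ}

/-- The kernel of an algebra map to a product of matrix algebras, as a subspace. -/
def rad (φ : A →ₐ[k] Π i, Matrix (Fin (d i)) (Fin (d i)) k) : Submodule k A :=
  LinearMap.ker φ.toLinearMap

variable {φ : A →ₐ[k] Π i, Matrix (Fin (d i)) (Fin (d i)) k}

theorem mem_rad {x : A} : x ∈ rad φ ↔ φ x = 0 := Iff.rfl

/-- Powers are taken among subspaces, so the zeroth power is the line of scalars and not an ideal;
hence `1 ≤ n` here and below. -/
theorem mul_mem_rad_pow_left {n : ℕ} (hn : 1 ≤ n) (a : A) {x : A} (hx : x ∈ rad φ ^ n) :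
    a * x ∈ rad φ ^ n := by
  obtain ⟨n, rfl⟩ := Nat.exists_eq_add_of_le' hn
  rw [pow_succ'] at hx ⊢
  refine Submodule.mul_induction_on hx (fun y hy z hz => ?_) fun y z hy hz => ?_
  · rw [← mul_assoc]
    exact Submodule.mul_mem_mul (by rw [mem_rad] at hy ⊢; rw [map_mul, hy, mul_zero]) hz
  · rw [mul_add]; exact add_mem hy hz

theorem mul_mem_rad_pow_right {n : ℕ} (hn : 1 ≤ n) (a : A) {x : A} (hx : x ∈ rad φ ^ n) :
    x * a ∈ rad φ ^ n := by
  obtain ⟨n, rfl⟩ := Nat.exists_eq_add_of_le' hn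
  rw [pow_succ] at hx ⊢
  refine Submodule.mul_induction_on hx (fun y hy z hz => ?_) fun y z hy hz => ?_
  · rw [mul_assoc]
    exact Submodule.mul_mem_mul hy (by rw [mem_rad] at hz ⊢; rw [map_mul, hz, zero_mul])
  · rw [add_mul]; exact add_mem hy hz

theorem mul_mem_rad_pow_add {m n : ℕ} {x y : A} (hx : x ∈ rad φ ^ m) (hy : y ∈ rad φ ^ n) :
    x * y ∈ rad φ ^ (m + n) := by
  rw [pow_add]; exact Submodule.mul_mem_mul hx hy

theorem rad_pow_le {m n : ℕ} (hm : 1 ≤ m) (hmn : m ≤ n) : rad φ ^ n ≤ rad φ ^ m := by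
  induction n, hmn using Nat.le_induction with
  | base => exact le_rfl
  | succ n hmn ih =>
    refine le_trans ?_ ih
    rw [pow_succ]
    exact Submodule.mul_le.2 fun x hx y _ => mul_mem_rad_pow_right (hm.trans hmn) y hx

theorem rad_pow_le_rad {n : ℕ} (hn : 1 ≤ n) : rad φ ^ n ≤ rad φ := by
  simpa using rad_pow_le (φ := φ) le_rfl hn

/-- The image of `a` is concentrated in the `i`-th matrix block. -/
def SupportedAt (φ : A →ₐ[k] Π i, Matrix (Fin (d i)) (Fin (d i)) k) (i : ι) (a : A) : Prop :=
  ∀ l, l ≠ i → φ a l = 0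

/-- The `(i, j)`-block of the bimodule `J ^ n / J ^ (n + 1)` is nonzero. -/
def Link (φ : A →ₐ[k] Π i, Matrix (Fin (d i)) (Fin (d i)) k) (n : ℕ) (i j : ι) : Prop :=
  ∃ x ∈ rad φ ^ n, ∃ a b, SupportedAt φ i a ∧ SupportedAt φ j b ∧ a * x * b ∉ rad φ ^ (n + 1)

theorem SupportedAt.mul_mem_rad {i : ι} {a : A} (ha : SupportedAt φ i a) {x : A}
    (hx : φ x i = 0) : x * a ∈ rad φ := by
  rw [mem_rad, map_mul]
  funext l
  by_cases hl : l = i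
  · subst hl; simp [hx]
  · simp [ha l hl]

theorem SupportedAt.mem_rad_mul {i : ι} {a : A} (ha : SupportedAt φ i a) {x : A}
    (hx : φ x i = 0) : a * x ∈ rad φ := by
  rw [mem_rad, map_mul]
  funext l
  by_cases hl : l = i
  · subst hl; simp [hx]
  · simp [ha l hl]

variable [DecidableEq ι]

theorem supportedAt_of_eq_single {i : ι} {a : A} {M} (h : φ a = Pi.single i M) :
    SupportedAt φ i a := fun l hl => by rw [h, Pi.single_eq_of_ne hl]

theorem SupportedAt.eq_single {i : ι} {a : A} (h : SupportedAt φ i a) :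
    φ a = Pi.single i (φ a i) := by
  funext l
  by_cases hl : l = i
  · subst hl; simp
  · rw [h l hl, Pi.single_eq_of_ne hl]

theorem matrix_eq_sum_mul_single_mul {n : ℕ} (M : Matrix (Fin n) (Fin n) k) (p : Fin n) :
    M = ∑ r, M * Matrix.single r p 1 * Matrix.single p p 1 * Matrix.single p r 1 := by
  simp only [mul_assoc, Matrix.single_mul_single_same, mul_one, ← Finset.mul_sum]
  rw [Matrix.sum_single_one, mul_one]

/-- An element supported at a block is, modulo the radical, a combination of multiples of any
lift of a diagonal matrix unit of this block. -/
theorem SupportedAt.exists_sum (hφ : Function.Surjective φ) {i : ι} {a : A}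
    (ha : SupportedAt φ i a) {p : Fin (d i)} {e : A}
    (he : φ e = Pi.single i (Matrix.single p p 1)) :
    ∃ u v : Fin (d i) → A, a - ∑ r, u r * e * v r ∈ rad φ := by
  choose u hu using fun r => hφ (Pi.single i (φ a i * Matrix.single r p 1))
  choose v hv using fun r => hφ (Pi.single i (Matrix.single p r 1))
  refine ⟨u, v, ?_⟩
  rw [mem_rad, map_sub, map_sum, ha.eq_single, sub_eq_zero]
  conv_lhs => rw [matrix_eq_sum_mul_single_mul (φ a i) p]
  simp only [map_mul, hu, hv, he, ← Pi.single_mul]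
  exact map_sum (AddMonoidHom.single (fun i => Matrix (Fin (d i)) (Fin (d i)) k) i) _ _

/-- A matrix block is generated as a two-sided ideal by any diagonal matrix unit, so a nonzero block
of `J ^ n / J ^ (n + 1)` is nonzero in each of its primitive corners `(p, q)`. This is what later
makes one link count for many dimensions. -/
theorem Link.exists_mul_mul_notMem (hφ : Function.Surjective φ) {n : ℕ} (hn : 1 ≤ n) {i j : ι}
    (h : Link φ n i j) {p : Fin (d i)} {q : Fin (d j)} {e f : A}
    (he : φ e = Pi.single i (Matrix.single p p 1))
    (hf : φ f = Pi.single j (Matrix.single q q 1)) :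
    ∃ x ∈ rad φ ^ n, e * x * f ∉ rad φ ^ (n + 1) := by
  by_contra! hcon
  obtain ⟨x, hx, a, b, ha, hb, hab⟩ := h
  obtain ⟨u, v, huv⟩ := ha.exists_sum hφ he
  obtain ⟨u', v', huv'⟩ := hb.exists_sum hφ hf
  apply hab
  -- Replacing `a` and `b` by combinations of multiples of `e` and `f` costs an element of `J` next
  -- to `x`, hence only terms of `J ^ (n + 1)`.
  have h1 : (a - ∑ r, u r * e * v r) * x * b ∈ rad φ ^ (n + 1) := by
    refine mul_mem_rad_pow_right (by omega) _ ?_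
    rw [pow_succ']
    exact Submodule.mul_mem_mul huv hx
  have h2 : (∑ r, u r * e * v r) * (x * (b - ∑ s, u' s * f * v' s)) ∈ rad φ ^ (n + 1) := by
    refine mul_mem_rad_pow_left (by omega) _ ?_
    rw [pow_succ]
    exact Submodule.mul_mem_mul hx huv'
  have h3 : (∑ r, u r * e * v r) * (x * ∑ s, u' s * f * v' s) ∈ rad φ ^ (n + 1) := by
    rw [Finset.mul_sum, Finset.sum_mul_sum]
    refine sum_mem fun r _ => sum_mem fun s _ => ?_
    have := mul_mem_rad_pow_left (by omega) (u r) (mul_mem_rad_pow_right (by omega) (v' s)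
      (hcon (v r * x * u' s)
        (mul_mem_rad_pow_right hn _ (mul_mem_rad_pow_left hn _ hx))))
    simpa only [mul_assoc] using this
  have := add_mem (add_mem h1 h2) h3
  convert this using 1
  simp only [mul_sub, sub_mul, mul_assoc]
  abel

end Radical

/-! ### Surjections onto a matrix algebra factor through one block -/

section Prime

variable {k A : Type*} [Field k] [Ring A] [Algebra k A]
variable {ι : Type*} {d : ι → ℕ}
variable {φ : A →ₐ[k] Π i, Matrix (Fin (d i)) (Fin (d i)) k}

theorem matrix_exists_mul_mul_ne_zero {m : ℕ} {X Z : Matrix (Fin m) (Fin m) k} (hX : X ≠ 0)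
    (hZ : Z ≠ 0) : ∃ Y, X * Y * Z ≠ 0 := by
  obtain ⟨a, b, hab⟩ : ∃ a b, X a b ≠ 0 := by
    by_contra! h; exact hX (Matrix.ext h)
  obtain ⟨c, e, hce⟩ : ∃ c e, Z c e ≠ 0 := by
    by_contra! h; exact hZ (Matrix.ext h)
  refine ⟨Matrix.single b c 1, fun h => mul_ne_zero hab hce ?_⟩
  have := congrFun (congrFun h a) e
  rw [Matrix.mul_apply, Finset.sum_eq_single c] at this
  · simpa using this
  · intro y _ hy
    rw [Matrix.mul_single_apply_of_ne _ _ _ _ _ hy, zero_mul]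
  · simp

/-- Matrix algebras are prime: if `ψ z ≠ 0`, products `z y z y' z ⋯` with nonzero image exist in
every power of the radical. -/
theorem map_rad_eq_zero {N : ℕ} (hN : rad φ ^ N = ⊥) {m : ℕ}
    {ψ : A →ₐ[k] Matrix (Fin m) (Fin m) k} (hψ : Function.Surjective ψ) {z : A}
    (hz : z ∈ rad φ) : ψ z = 0 := by
  by_contra h0
  have key : ∀ n, ∃ w ∈ rad φ ^ (n + 1), ψ w ≠ 0 := by
    intro n
    induction n with
    | zero => exact ⟨z, by simpa using hz, h0⟩
    | succ n ih =>
      obtain ⟨w, hw, hw0⟩ := ih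
      obtain ⟨Y, hY⟩ := matrix_exists_mul_mul_ne_zero hw0 h0
      obtain ⟨y, rfl⟩ := hψ Y
      refine ⟨w * y * z, ?_, by simpa using hY⟩
      rw [pow_succ _ (n + 1)]
      exact Submodule.mul_mem_mul (mul_mem_rad_pow_right (by omega) y hw) hz
  obtain ⟨w, hw, hw0⟩ := key N
  rw [pow_succ, hN, Submodule.bot_mul, Submodule.mem_bot] at hw
  exact hw0 (by rw [hw, map_zero])

theorem map_eq_zero_of_supportedAt {N : ℕ} (hN : rad φ ^ N = ⊥) {m : ℕ}
    {ψ : A →ₐ[k] Matrix (Fin m) (Fin m) k} (hψ : Function.Surjective ψ) {i : ι} {a : A}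
    (ha : SupportedAt φ i a) (h0 : ψ a ≠ 0) {x : A} (hx : φ x i = 0) : ψ x = 0 := by
  by_contra hx0
  obtain ⟨Y, hY⟩ := matrix_exists_mul_mul_ne_zero hx0 h0
  obtain ⟨y, rfl⟩ := hψ Y
  refine hY ?_
  rw [← map_mul, ← map_mul]
  exact map_rad_eq_zero hN hψ (ha.mul_mem_rad (by simp [hx]))

variable [DecidableEq ι]

/-- The projection to block `i` and `ψ` have the same kernel: one inclusion is primeness of the
target of `ψ`, the other is simplicity of the block. The quotients then have equal dimensions `d i ^
2` and `m ^ 2`. -/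
theorem size_eq_of_supportedAt (hφ : Function.Surjective φ) {N : ℕ} (hN : rad φ ^ N = ⊥) {m : ℕ}
    {ψ : A →ₐ[k] Matrix (Fin m) (Fin m) k} (hψ : Function.Surjective ψ) {i : ι} {a : A}
    (ha : SupportedAt φ i a) (h0 : ψ a ≠ 0) : d i = m := by
  let φi : A →ₐ[k] Matrix (Fin (d i)) (Fin (d i)) k := (Pi.evalAlgHom k _ i).comp φ
  have hφi : Function.Surjective φi := fun M => by
    obtain ⟨x, hx⟩ := hφ (Pi.single i M)
    exact ⟨x, by simp [φi, hx]⟩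
  have hker : ∀ x, φi x = 0 → ψ x = 0 := fun x hx => map_eq_zero_of_supportedAt hN hψ ha h0 hx
  have hne : Nonempty (Fin m) := by
    by_contra hm
    rw [not_nonempty_iff] at hm
    exact h0 (Subsingleton.elim _ _)
  have hker' : ∀ x, ψ x = 0 → φi x = 0 := by
    intro x hx
    by_contra hx0
    have h1 : φi a ≠ 0 := fun h => h0 (hker a h)
    obtain ⟨b, c, hbc⟩ : ∃ b c, φi x b c ≠ 0 := by
      by_contra! h; exact hx0 (Matrix.ext h)
    choose u hu using fun r => hφi (Matrix.single r b (φi x b c)⁻¹)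
    choose v hv using fun r => hφi (Matrix.single c r 1)
    have hw : φi (∑ r, u r * x * v r) = 1 := by
      simp only [map_sum, map_mul, hu, hv]
      rw [← Matrix.sum_single_one]
      refine Finset.sum_congr rfl fun r _ => ?_
      rw [Matrix.single_mul_mul_single, inv_mul_cancel₀ hbc, one_mul]
    have h2 : ψ (1 - ∑ r, u r * x * v r) = 0 := hker _ (by rw [map_sub, hw, map_one, sub_self])
    rw [map_sub, map_one] at h2
    simp [hx] at h2
  have e1 : Module.finrank k (Matrix (Fin (d i)) (Fin (d i)) k) =
      Module.finrank k (Matrix (Fin m) (Fin m) k) := by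
    have hk : RingHom.ker φi = RingHom.ker ψ := by
      ext x; exact ⟨hker x, hker' x⟩
    exact (((Ideal.quotientKerAlgEquivOfSurjective hφi).symm.trans
      (Ideal.quotientEquivAlgOfEq k hk)).trans
      (Ideal.quotientKerAlgEquivOfSurjective hψ)).toLinearEquiv.finrank_eq
  simp only [Module.finrank_matrix, Fintype.card_fin, Module.finrank_self, mul_one] at e1
  exact Nat.mul_self_inj.1 e1

end Prime

/-! ### Frobenius algebras: Nakayama automorphism, tops and socles -/

section Frobenius

variable {k A : Type*} [Field k] [Ring A] [Algebra k A] [FiniteDimensional k A]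

/-- The Nakayama automorphism of a Frobenius form, as a surjective algebra endomorphism. -/
theorem exists_nakayama (t : A →ₗ[k] k) (ht : ∀ a, (∀ b, t (a * b) = 0) → a = 0) :
    ∃ ν : A →ₐ[k] A, Function.Surjective ν ∧ ∀ a b, t (a * b) = t (b * ν a) := by
  let L : A →ₗ[k] Module.Dual k A := (LinearMap.mul k A).compr₂ t
  have hLi : Function.Injective L := by
    rw [injective_iff_map_eq_zero]
    exact fun a ha => ht a fun b => LinearMap.congr_fun ha b
  have hfr : Module.finrank k A = Module.finrank k (Module.Dual k A) :=
    Subspace.dual_finrank_eq.symm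
  have hLs := (LinearMap.injective_iff_surjective_of_finrank_eq_finrank hfr).1 hLi
  let R : A →ₗ[k] Module.Dual k A := (LinearMap.mul k A).flip.compr₂ t
  have hRi : Function.Injective R := by
    rw [injective_iff_map_eq_zero]
    intro a ha
    rw [← Module.forall_dual_apply_eq_zero_iff k]
    intro f
    obtain ⟨b, rfl⟩ := hLs f
    exact LinearMap.congr_fun ha b
  have hRs := (LinearMap.injective_iff_surjective_of_finrank_eq_finrank hfr).1 hRi
  -- Nondegeneracy on the right followed from that on the left by dimension, so the functional `t (a
  -- * -)` can be rewritten as `t (- * ν a)`.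
  choose ν hν using fun a => hRs (L a)
  have hν' : ∀ a b, t (a * b) = t (b * ν a) := fun a b => (LinearMap.congr_fun (hν a) b).symm
  have huniq : ∀ c c', (∀ b, t (b * c) = t (b * c')) → c = c' := fun c c' h =>
    hRi (LinearMap.ext h)
  let νl : A →ₗ[k] A :=
    { toFun := ν
      map_add' := fun a b => huniq _ _ fun c => by
        rw [mul_add, map_add, ← hν', ← hν', ← hν', add_mul, map_add]
      map_smul' := fun r a => huniq _ _ fun c => by
        rw [← hν', RingHom.id_apply, mul_smul_comm, map_smul, ← hν', smul_mul_assoc, map_smul] }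
  refine ⟨AlgHom.ofLinearMap νl (huniq _ _ fun c => ?_) fun a b => huniq _ _ fun c => ?_, ?_, hν'⟩
  · change t (c * ν 1) = _
    rw [← hν', one_mul, mul_one]
  · change t (c * ν (a * b)) = t (c * (ν a * ν b))
    rw [← hν', mul_assoc, hν' a, ← mul_assoc c, ← hν' b, mul_assoc]
  · change Function.Surjective νl
    refine LinearMap.injective_iff_surjective.1 ?_
    rw [injective_iff_map_eq_zero]
    intro a ha
    refine ht a fun b => ?_
    rw [hν']
    change t (b * νl a) = 0
    rw [ha, mul_zero, map_zero]

variable {ι : Type*} {d : ι → ℕ} [DecidableEq ι]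
variable {φ : A →ₐ[k] Π i, Matrix (Fin (d i)) (Fin (d i)) k}

/-- In a Frobenius algebra, the block of the right socle of a projective module has the size of
the block of its top. -/
theorem size_eq_of_socle (hφ : Function.Surjective φ) {N : ℕ} (hN : rad φ ^ N = ⊥)
    (t : A →ₗ[k] k) (ht : ∀ a, (∀ b, t (a * b) = 0) → a = 0) {i j : ι} {e y : A}
    (he : SupportedAt φ i e) (hy0 : y ≠ 0) (hey : e * y = y) (hy : ∀ z, φ z j = 0 → y * z = 0) :
    d i = d j := by
  obtain ⟨ν, hν, htν⟩ := exists_nakayama t ht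
  -- Twist the representation of block `j` by `ν`. If it killed `e`, then `t (y b) = t (e y b) = t
  -- (y b ν(e)) = 0` for all `b`, since `b ν(e)` would vanish in block `j`; this would force `y =
  -- 0`.
  refine size_eq_of_supportedAt hφ hN
    (ψ := ((Pi.evalAlgHom k (fun i => Matrix (Fin (d i)) (Fin (d i)) k) j).comp φ).comp ν)
    (fun M => ?_) he fun h0 => hy0 (ht y fun b => ?_)
  · obtain ⟨x, hx⟩ := hφ (Pi.single j M)
    obtain ⟨z, rfl⟩ := hν x
    exact ⟨z, by simp [hx]⟩
  · rw [← hey, mul_assoc, htν, mul_assoc, hy, map_zero]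
    rw [map_mul, Pi.mul_apply]
    change _ * (φ (ν e) j) = 0
    rw [show φ (ν e) j = 0 from h0, mul_zero]

end Frobenius

end HopfCoradical

namespace HopfCoradical

/-! ### Links at a block of size one -/

section Blocks

variable {k A : Type*} [Field k] [Ring A] [Algebra k A]
variable {ι : Type*} {d : ι → ℕ}
variable {φ : A →ₐ[k] Π i, Matrix (Fin (d i)) (Fin (d i)) k}

theorem exists_maximal_power {N : ℕ} (hN : rad φ ^ N = ⊥) {e : A}
    (h : ∃ x ∈ rad φ, e * x ≠ 0) :
    ∃ n, 1 ≤ n ∧ (∃ x ∈ rad φ ^ n, e * x ≠ 0) ∧ ∀ x ∈ rad φ ^ (n + 1), e * x = 0 := by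
  classical
  have hex : ∃ n, ∀ x ∈ rad φ ^ (n + 1), e * x = 0 := ⟨N, fun x hx => by
    rw [pow_succ, hN, Submodule.bot_mul, Submodule.mem_bot] at hx
    rw [hx, mul_zero]⟩
  obtain ⟨x, hx, hx0⟩ := h
  have h1 : 1 ≤ Nat.find hex := by
    by_contra h0
    have := Nat.find_spec hex
    rw [show Nat.find hex = 0 by omega, zero_add, pow_one] at this
    exact hx0 (this x hx)
  refine ⟨Nat.find hex, h1, ?_, Nat.find_spec hex⟩
  have := Nat.find_min hex (Nat.sub_lt h1 one_pos)
  push Not at this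
  rwa [Nat.sub_add_cancel h1] at this

variable [Fintype ι] [DecidableEq ι]

/-- There are orthogonal idempotents lifting the identities of the blocks. -/
theorem exists_block_idempotents (hφ : Function.Surjective φ) {N : ℕ} (hN : rad φ ^ N = ⊥) :
    ∃ e : ι → A, CompleteOrthogonalIdempotents e ∧ ∀ i, φ (e i) = Pi.single i 1 := by
  obtain ⟨e, he, h⟩ := CompleteOrthogonalIdempotents.lift_of_isNilpotent_ker (φ : A →+* _)
    (fun x hx => ⟨N, by
      have := Submodule.pow_mem_pow (rad φ) (mem_rad.2 hx) N
      rwa [hN, Submodule.mem_bot] at this⟩)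
    (CompleteOrthogonalIdempotents.single (fun i => Matrix (Fin (d i)) (Fin (d i)) k))
    (fun i => (hφ _).imp fun _ h => h)
  exact ⟨e, he, fun i => congrFun h i⟩

/-- The top and the socle of a nonsimple projective indecomposable module over a Frobenius algebra
belong to blocks of the same size. -/
theorem exists_link_socle [FiniteDimensional k A] (hφ : Function.Surjective φ) {N : ℕ}
    (hN : rad φ ^ N = ⊥) (t : A →ₗ[k] k) (ht : ∀ a, (∀ b, t (a * b) = 0) → a = 0)
    {e : ι → A} (he : CompleteOrthogonalIdempotents e) (hφe : ∀ i, φ (e i) = Pi.single i 1)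
    {i : ι} (hi : ∃ x ∈ rad φ, e i * x ≠ 0) :
    ∃ n j, 1 ≤ n ∧ d j = d i ∧ Link φ n i j ∧ (∀ x ∈ rad φ ^ (n + 1), e i * x = 0) ∧
      ∀ l, (∃ x ∈ rad φ ^ n, e i * x * e l ≠ 0) → d l = d i := by
  obtain ⟨n, hn, ⟨x, hx, hx0⟩, hn'⟩ := exists_maximal_power hN hi
  have hsupp : ∀ i, SupportedAt φ i (e i) := fun i => supportedAt_of_eq_single (hφe i)
  have key : ∀ l, (∃ x ∈ rad φ ^ n, e i * x * e l ≠ 0) → d l = d i := by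
    rintro l ⟨x, hx, hx0⟩
    -- As `e i` kills `J ^ (n + 1)`, the element `e i * x * e l` is annihilated on the right by
    -- everything vanishing in block `l`: it is a socle element of type `l`.
    refine (size_eq_of_socle hφ hN t ht (hsupp i) hx0 ?_ fun z hz => ?_).symm
    · rw [← mul_assoc, ← mul_assoc, (he.idem i).eq]
    · rw [mul_assoc, mul_assoc]
      refine hn' _ ?_
      rw [pow_succ]
      exact Submodule.mul_mem_mul hx ((hsupp l).mem_rad_mul hz)
  obtain ⟨j, hj⟩ : ∃ j, e i * x * e j ≠ 0 := by
    by_contra! h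
    apply hx0
    rw [← mul_one (e i * x), ← he.complete, Finset.mul_sum]
    exact Finset.sum_eq_zero fun j _ => h j
  refine ⟨n, j, hn, key j ⟨x, hx, hj⟩, ⟨x, hx, e i, e j, hsupp i, hsupp j, fun h => hj ?_⟩, hn',
    key⟩
  rw [← hn' _ h, ← mul_assoc, ← mul_assoc, (he.idem i).eq]

/-- A Nakayama-lemma argument: without links `e i * J` lies in `J ^ 2`, and idempotency of `e i`
lets this inclusion be iterated until nilpotency gives zero. -/
theorem exists_link_right {N : ℕ} (hN : rad φ ^ N = ⊥)
    {e : ι → A} (he : CompleteOrthogonalIdempotents e) (hφe : ∀ i, φ (e i) = Pi.single i 1)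
    {i : ι} (hi : ∃ x ∈ rad φ, e i * x ≠ 0) : ∃ j, Link φ 1 i j := by
  have hsupp : ∀ i, SupportedAt φ i (e i) := fun i => supportedAt_of_eq_single (hφe i)
  obtain ⟨x, hx, hx0⟩ := hi
  by_contra! h
  have h1 : ∀ x ∈ rad φ, e i * x ∈ rad φ ^ 2 := by
    intro x hx
    rw [← mul_one (e i * x), ← he.complete, Finset.mul_sum]
    refine sum_mem fun j _ => ?_
    by_contra h2
    exact h j ⟨x, by simpa using hx, e i, e j, hsupp i, hsupp j, h2⟩
  have h2 : ∀ n, ∀ x ∈ rad φ, e i * x ∈ rad φ ^ (n + 1) := by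
    intro n
    induction n with
    | zero => intro x hx; simpa using mul_mem_rad_pow_left le_rfl (e i) (by simpa using hx)
    | succ n ih =>
      intro x hx
      have key : ∀ y ∈ rad φ ^ 2, e i * y ∈ rad φ ^ (n + 1 + 1) := by
        intro y hy
        rw [pow_two] at hy
        refine Submodule.mul_induction_on hy (fun a ha b hb => ?_) fun a b ha hb => ?_
        · rw [← mul_assoc, pow_succ]
          exact Submodule.mul_mem_mul (ih a ha) hb
        · rw [mul_add]; exact add_mem ha hb
      have := key _ (h1 x hx)
      rwa [← mul_assoc, (he.idem i).eq] at this
  have := h2 N x hx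
  rw [pow_succ, hN, Submodule.bot_mul, Submodule.mem_bot] at this
  exact hx0 this

theorem exists_link_left {N : ℕ} (hN : rad φ ^ N = ⊥)
    {e : ι → A} (he : CompleteOrthogonalIdempotents e) (hφe : ∀ i, φ (e i) = Pi.single i 1)
    {i : ι} (hi : ∃ x ∈ rad φ, x * e i ≠ 0) : ∃ j, Link φ 1 j i := by
  have hsupp : ∀ i, SupportedAt φ i (e i) := fun i => supportedAt_of_eq_single (hφe i)
  obtain ⟨x, hx, hx0⟩ := hi
  by_contra! h
  have h1 : ∀ x ∈ rad φ, x * e i ∈ rad φ ^ 2 := by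
    intro x hx
    rw [← one_mul (x * e i), ← he.complete, Finset.sum_mul]
    refine sum_mem fun j _ => ?_
    by_contra h2
    exact h j ⟨x, by simpa using hx, e j, e i, hsupp j, hsupp i, by rwa [mul_assoc]⟩
  have h2 : ∀ n, ∀ x ∈ rad φ, x * e i ∈ rad φ ^ (n + 1) := by
    intro n
    induction n with
    | zero => intro x hx; simpa using mul_mem_rad_pow_right le_rfl (e i) (by simpa using hx)
    | succ n ih =>
      intro x hx
      have key : ∀ y ∈ rad φ ^ 2, y * e i ∈ rad φ ^ (n + 1 + 1) := by
        intro y hy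
        rw [pow_two] at hy
        refine Submodule.mul_induction_on hy (fun a ha b hb => ?_) fun a b ha hb => ?_
        · rw [mul_assoc, pow_succ']
          exact Submodule.mul_mem_mul ha (ih b hb)
        · rw [add_mul]; exact add_mem ha hb
      have := key _ (h1 x hx)
      rwa [mul_assoc, (he.idem i).eq] at this
  have := h2 N x hx
  rw [pow_succ, hN, Submodule.bot_mul, Submodule.mem_bot] at this
  exact hx0 this

/-- The links of a one-dimensional block in a Frobenius algebra without projective one-dimensional
modules and without links between one-dimensional blocks. -/
theorem links_of_frobenius [FiniteDimensional k A] (hd : ∀ i, 1 ≤ d i)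
    (hφ : Function.Surjective φ) {N : ℕ}
    (hN : rad φ ^ N = ⊥) (t : A →ₗ[k] k) (ht : ∀ a, (∀ b, t (a * b) = 0) → a = 0)
    (hr : ∀ (i : ι) (e : A), d i = 1 → IsIdempotentElem e → φ e = Pi.single i 1 →
      ∃ x ∈ rad φ, e * x ≠ 0)
    (hl : ∀ (i : ι) (e : A), d i = 1 → IsIdempotentElem e → φ e = Pi.single i 1 →
      ∃ x ∈ rad φ, x * e ≠ 0)
    (hs : ∀ i j, d i = 1 → d j = 1 → ¬ Link φ 1 i j) (g : ι) (hg : d g = 1) :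
    (∃ C, 1 < d C ∧ Link φ 1 C g ∧ ∃ n D, 1 < n ∧ d D = d C ∧ Link φ n C D) ∧
      (∃ C, 1 < d C ∧ Link φ 1 g C) ∧ ∃ m h, 1 < m ∧ d h = 1 ∧ Link φ m g h := by
  obtain ⟨e, he, hφe⟩ := exists_block_idempotents hφ hN
  have hsupp : ∀ i, SupportedAt φ i (e i) := fun i => supportedAt_of_eq_single (hφe i)
  have hbig : ∀ C, d C ≠ 1 → 1 < d C := fun C h => by have := hd C; omega
  refine ⟨?_, ?_, ?_⟩
  · obtain ⟨C, hC⟩ := exists_link_left hN he hφe (hl g (e g) hg (he.idem g) (hφe g))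
    have hC1 : d C ≠ 1 := fun h => hs C g h hg hC
    refine ⟨C, hbig C hC1, hC, ?_⟩
    obtain ⟨x, hx, a, b, ha, hb, hab⟩ := hC
    rw [pow_one] at hx
    -- Modulo `J`, `a` and `b` are unchanged by multiplication with the lifted block identities, so
    -- these may be inserted modulo `J ^ 2`.
    have hxe : e C * (a * x * b) * e g ∉ rad φ ^ 2 := by
      intro h
      apply hab
      have h1 : a - e C * a ∈ rad φ := by
        rw [mem_rad, map_sub, map_mul, hφe, ha.eq_single, ← Pi.single_mul, one_mul, sub_self]
      have h2 : b - b * e g ∈ rad φ := by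
        rw [mem_rad, map_sub, map_mul, hφe, hb.eq_single, ← Pi.single_mul, mul_one, sub_self]
      have h3 : (a - e C * a) * (x * b) ∈ rad φ ^ 2 := by
        rw [pow_two]
        refine Submodule.mul_mem_mul h1 ?_
        simpa using mul_mem_rad_pow_right le_rfl b (by simpa using hx)
      have h4 : e C * a * x * (b - b * e g) ∈ rad φ ^ 2 := by
        rw [pow_two]
        refine Submodule.mul_mem_mul ?_ h2
        simpa using mul_mem_rad_pow_left le_rfl (e C * a) (by simpa using hx)
      have := add_mem (add_mem h3 h4) h
      convert this using 1
      simp only [mul_sub, sub_mul, mul_assoc]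
      abel
    have hy : a * x * b ∈ rad φ := by
      simpa using mul_mem_rad_pow_right le_rfl b (mul_mem_rad_pow_left le_rfl a (by simpa using hx))
    obtain ⟨n, D, hn, hD, hlink, -, hkey⟩ := exists_link_socle hφ hN t ht he hφe
      (i := C) ⟨a * x * b, hy, fun h => hxe (by rw [h, zero_mul]; exact zero_mem _)⟩
    refine ⟨n, D, ?_, hD, hlink⟩
    -- If `J` itself were the last power not killed by `e C`, the link from `C` to `g` would already
    -- lie in the socle, forcing `d g = d C`.
    rcases hn.lt_or_eq with h | rfl
    · exact h
    · refine absurd (hkey g ⟨a * x * b, by simpa using hy, fun h => hxe ?_⟩) ?_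
      · rw [h]; exact zero_mem _
      · rw [hg]; exact Ne.symm hC1
  · obtain ⟨C, hC⟩ := exists_link_right hN he hφe (hr g (e g) hg (he.idem g) (hφe g))
    exact ⟨C, hbig C fun h => hs g C hg h hC, hC⟩
  · obtain ⟨n, h, hn, hh, hlink, -, -⟩ := exists_link_socle hφ hN t ht he hφe
      (hr g (e g) hg (he.idem g) (hφe g))
    refine ⟨n, h, ?_, hh.trans hg, hlink⟩
    rcases hn.lt_or_eq with h' | rfl
    · exact h'
    · exact absurd hlink (hs g h hg (hh.trans hg))

end Blocks

/-! ### Counting dimensions by Peirce corners -/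

section Counting

variable {k A : Type*} [Field k] [Ring A] [Algebra k A] [FiniteDimensional k A]

/-- Representatives in different corners `e p (X / Y) e q` are linearly independent, because
multiplying by the idempotents isolates one corner. Each nonzero corner thus adds at least one
dimension. -/
theorem finrank_add_card_le {κ : Type*} [Fintype κ] {e : κ → A} (he : OrthogonalIdempotents e)
    {X Y : Submodule k A} (hYX : Y ≤ X) (hX : ∀ a b, ∀ x ∈ X, a * x * b ∈ X)
    (hY : ∀ a b, ∀ x ∈ Y, a * x * b ∈ Y) (s : Finset (κ × κ))
    (hs : ∀ p ∈ s, ∃ x ∈ X, e p.1 * x * e p.2 ∉ Y) :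
    Module.finrank k Y + s.card ≤ Module.finrank k X := by
  classical
  choose! x hx hxY using hs
  have hmul : ∀ p q : κ × κ, ∀ z, e p.1 * (e q.1 * z * e q.2) * e p.2 =
      if p = q then e p.1 * z * e p.2 else 0 := by
    intro p q z
    by_cases h1 : p.1 = q.1
    · by_cases h2 : p.2 = q.2
      · rw [if_pos (Prod.ext h1 h2), ← h1, ← h2, ← mul_assoc, ← mul_assoc, (he.idem _).eq,
          mul_assoc, (he.idem _).eq]
      · rw [if_neg fun h : p = q => h2 (congrArg Prod.snd h), mul_assoc, mul_assoc (e q.1 * z),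
          he.ortho (Ne.symm h2),
          mul_zero, mul_zero]
    · rw [if_neg fun h : p = q => h1 (congrArg Prod.fst h), ← mul_assoc, ← mul_assoc, he.ortho h1]
      simp
  let y : s → X ⧸ Y.submoduleOf X := fun p =>
    Submodule.Quotient.mk ⟨e p.1.1 * x p.1 * e p.1.2, hX _ _ _ (hx p.1 p.2)⟩
  have hli : LinearIndependent k y := by
    rw [Fintype.linearIndependent_iff]
    intro c hc p
    have h1 : (∑ q : s, c q • (⟨e q.1.1 * x q.1 * e q.1.2, hX _ _ _ (hx q.1 q.2)⟩ : X)) ∈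
        Y.submoduleOf X := by
      rw [← Submodule.Quotient.mk_eq_zero, ← Submodule.mkQ_apply, map_sum]
      exact hc
    change Submodule.subtype X _ ∈ Y at h1
    rw [Submodule.subtype_apply] at h1
    simp only [Submodule.coe_sum, Submodule.coe_smul] at h1
    have h2 := hY (e p.1.1) (e p.1.2) _ h1
    have h3 : e p.1.1 * (∑ q : s, c q • (e q.1.1 * x q.1 * e q.1.2)) * e p.1.2 =
        c p • (e p.1.1 * x p.1 * e p.1.2) := by
      rw [Finset.mul_sum, Finset.sum_mul, Finset.sum_eq_single p]
      · rw [mul_smul_comm, smul_mul_assoc, hmul, if_pos rfl]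
      · intro q _ hq
        rw [mul_smul_comm, smul_mul_assoc, hmul, if_neg fun h => hq (Subtype.ext h.symm), smul_zero]
      · simp
    rw [h3] at h2
    by_contra hcp
    exact hxY p.1 p.2 ((Submodule.smul_mem_iff _ hcp).1 h2)
  have h1 := hli.fintype_card_le_finrank
  rw [Fintype.card_coe] at h1
  have h2 := Submodule.finrank_quotient_add_finrank (Y.submoduleOf X)
  rw [(Submodule.submoduleOfEquivOfLe hYX).finrank_eq] at h2
  omega

end Counting

end HopfCoradical

namespace HopfCoradical

section DimensionBound

variable {k A : Type*} [Field k] [Ring A] [Algebra k A]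
variable {ι : Type*} {d : ι → ℕ} [Fintype ι]
variable {φ : A →ₐ[k] Π i, Matrix (Fin (d i)) (Fin (d i)) k}

theorem finrank_rad_add [FiniteDimensional k A] (hφ : Function.Surjective φ) :
    Module.finrank k (rad φ) + ∑ i, d i ^ 2 = Module.finrank k A := by
  have h1 := LinearMap.finrank_range_add_finrank_ker φ.toLinearMap
  rw [LinearMap.range_eq_top.2 (by simpa using hφ), finrank_top, Module.finrank_pi_fintype] at h1
  simp only [Module.finrank_matrix, Fintype.card_fin, Module.finrank_self, mul_one] at h1
  change Module.finrank k (LinearMap.ker φ.toLinearMap) + _ = _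
  rw [← h1, add_comm]
  simp only [pow_two]

variable [DecidableEq ι]

theorem completeOrthogonalIdempotents_matrixUnits (k : Type*) [Field k] (d : ι → ℕ) :
    CompleteOrthogonalIdempotents fun p : Σ i, Fin (d i) =>
      (Pi.single p.1 (Matrix.single p.2 p.2 1) : Π i, Matrix (Fin (d i)) (Fin (d i)) k) where
  idem p := by
    rw [IsIdempotentElem, ← Pi.single_mul, Matrix.single_mul_single_same, mul_one]
  ortho p q hpq := by
    obtain ⟨i, p⟩ := p
    obtain ⟨j, q⟩ := q
    by_cases h : i = j
    · subst h
      have : p ≠ q := fun h => hpq (by rw [h])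
      change Pi.single i _ * Pi.single i _ = 0
      rw [← Pi.single_mul, Matrix.single_mul_single_of_ne (h := this), Pi.single_zero]
    · change Pi.single i _ * Pi.single j _ = 0
      funext l
      by_cases hl : l = i
      · subst hl
        rw [Pi.mul_apply, Pi.single_eq_of_ne (M := fun i => Matrix (Fin (d i)) (Fin (d i)) k) h,
          mul_zero, Pi.zero_apply]
      · rw [Pi.mul_apply, Pi.single_eq_of_ne (M := fun i => Matrix (Fin (d i)) (Fin (d i)) k) hl,
          zero_mul, Pi.zero_apply]
  complete := by
    rw [Fintype.sum_sigma]
    funext l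
    rw [Finset.sum_apply, Finset.sum_eq_single l]
    · rw [Finset.sum_apply]
      simp only [Pi.single_eq_same]
      exact Matrix.sum_single_one
    · intro i _ hi
      rw [Finset.sum_apply]
      exact Finset.sum_eq_zero fun p _ => Pi.single_eq_of_ne (Ne.symm hi) _
    · simp

theorem exists_primitive_idempotents (hφ : Function.Surjective φ) {N : ℕ} (hN : rad φ ^ N = ⊥) :
    ∃ e : (Σ i, Fin (d i)) → A, CompleteOrthogonalIdempotents e ∧
      ∀ i p, φ (e ⟨i, p⟩) = Pi.single i (Matrix.single p p 1) := by
  obtain ⟨e, he, h⟩ := CompleteOrthogonalIdempotents.lift_of_isNilpotent_ker (φ : A →+* _)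
    (fun x hx => ⟨N, by
      have := Submodule.pow_mem_pow (rad φ) (mem_rad.2 hx) N
      rwa [hN, Submodule.mem_bot] at this⟩)
    (completeOrthogonalIdempotents_matrixUnits k d)
    (fun i => (hφ _).imp fun _ h => h)
  exact ⟨e, he, fun i p => congrFun h ⟨i, p⟩⟩

/-- The dimension of an algebra whose one-dimensional blocks have the links provided by
`links_of_frobenius`. -/
theorem finrank_ge_of_links [FiniteDimensional k A] (hφ : Function.Surjective φ) {N : ℕ}
    (hN : rad φ ^ N = ⊥) {n : ℕ} (hn : ∀ C, 1 < d C → n ≤ d C)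
    (hlinks : ∀ g, d g = 1 →
      (∃ C, 1 < d C ∧ Link φ 1 C g ∧ ∃ n D, 1 < n ∧ d D = d C ∧ Link φ n C D) ∧
      (∃ C, 1 < d C ∧ Link φ 1 g C) ∧ ∃ m h, 1 < m ∧ d h = 1 ∧ Link φ m g h)
    (g₀ : ι) (hg₀ : d g₀ = 1) :
    ∑ i, d i ^ 2 + (2 * n + 1) * Fintype.card {g // d g = 1} + n ^ 2 ≤ Module.finrank k A := by
  classical
  obtain ⟨e, he, hφe⟩ := exists_primitive_idempotents hφ hN
  choose C hC hCl n' D hn' hD hCD using fun g hg => (hlinks g hg).1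
  choose C' hC' hCl' using fun g hg => (hlinks g hg).2.1
  choose m h hm hh hl using fun g hg => (hlinks g hg).2.2
  have hlink : ∀ {n i j}, 1 ≤ n → Link φ n i j → ∀ p q,
      ∃ x ∈ rad φ ^ n, e ⟨i, p⟩ * x * e ⟨j, q⟩ ∉ rad φ ^ (n + 1) := fun hn hl p q =>
    hl.exists_mul_mul_notMem hφ hn (hφe _ p) (hφe _ q)
  have hideal : ∀ {n}, 1 ≤ n → ∀ a b, ∀ x ∈ rad φ ^ n, a * x * b ∈ rad φ ^ n :=
    fun hn a b x hx => mul_mem_rad_pow_right hn b (mul_mem_rad_pow_left hn a hx)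
  let G := {g // d g = 1}
  let z : ∀ g : G, Fin (d g.1) := fun g => ⟨0, by rw [g.2]; exact one_pos⟩
  -- The `2 n |G|` corners of `J / J ^ 2`: for each `g`, `n` rows of the block `(C g, g)` and `n`
  -- columns of `(g, C' g)`. Comparing block sizes shows that the two families are disjoint.
  let f₁ : G × Fin n ⊕ G × Fin n → (Σ i, Fin (d i)) × (Σ i, Fin (d i)) := Sum.elim
    (fun x => (⟨C x.1 x.1.2, x.2.castLE (hn _ (hC _ _))⟩, ⟨x.1, z x.1⟩))
    (fun x => (⟨x.1, z x.1⟩, ⟨C' x.1 x.1.2, x.2.castLE (hn _ (hC' _ _))⟩))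
  have hf₁ : Function.Injective f₁ := by
    rintro (⟨⟨g, hg⟩, r⟩ | ⟨⟨g, hg⟩, r⟩) (⟨⟨g', hg'⟩, r'⟩ | ⟨⟨g', hg'⟩, r'⟩) hx
    · obtain ⟨h1, h2⟩ := Prod.ext_iff.1 hx
      obtain rfl : g = g' := congrArg Sigma.fst h2
      have : Fin.castLE _ r = Fin.castLE _ r' := eq_of_heq (Sigma.mk.inj h1).2
      rw [Fin.castLE_inj] at this
      rw [this]
    · obtain ⟨h1, h2⟩ := Prod.ext_iff.1 hx
      have h3 : C g hg = g' := congrArg Sigma.fst h1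
      have := hC g hg
      rw [h3, hg'] at this
      exact absurd this (lt_irrefl _)
    · obtain ⟨h1, h2⟩ := Prod.ext_iff.1 hx
      have h3 : g = C g' hg' := congrArg Sigma.fst h1
      have := hC g' hg'
      rw [← h3, hg] at this
      exact absurd this (lt_irrefl _)
    · obtain ⟨h1, h2⟩ := Prod.ext_iff.1 hx
      obtain rfl : g = g' := congrArg Sigma.fst h1
      have : Fin.castLE _ r = Fin.castLE _ r' := eq_of_heq (Sigma.mk.inj h2).2
      rw [Fin.castLE_inj] at this
      rw [this]
  -- The `|G| + n ^ 2` corners of `J ^ 2`: one for each pair `(g, h g)`, and an `n × n` square in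
  -- the block `(C, D)` of the single `g₀`, since different `g` may share the same `C` and `D`.
  let f₂ : G ⊕ Fin n × Fin n → (Σ i, Fin (d i)) × (Σ i, Fin (d i)) := Sum.elim
    (fun g => (⟨g, z g⟩, ⟨h g g.2, z ⟨h g g.2, hh g g.2⟩⟩))
    (fun x => (⟨C g₀ hg₀, x.1.castLE (hn _ (hC _ _))⟩,
      ⟨D g₀ hg₀, x.2.castLE (by rw [hD]; exact hn _ (hC _ _))⟩))
  have hf₂ : Function.Injective f₂ := by
    rintro (⟨g, hg⟩ | ⟨r, s⟩) (⟨g', hg'⟩ | ⟨r', s'⟩) hx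
    · obtain ⟨h1, h2⟩ := Prod.ext_iff.1 hx
      obtain rfl : g = g' := congrArg Sigma.fst h1
      rfl
    · obtain ⟨h1, h2⟩ := Prod.ext_iff.1 hx
      have h3 : g = C g₀ hg₀ := congrArg Sigma.fst h1
      have := hC g₀ hg₀
      rw [← h3, hg] at this
      exact absurd this (lt_irrefl _)
    · obtain ⟨h1, h2⟩ := Prod.ext_iff.1 hx
      have h3 : C g₀ hg₀ = g' := congrArg Sigma.fst h1
      have := hC g₀ hg₀
      rw [h3, hg'] at this
      exact absurd this (lt_irrefl _)
    · obtain ⟨h1, h2⟩ := Prod.ext_iff.1 hx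
      have h3 : Fin.castLE _ r = Fin.castLE _ r' := eq_of_heq (Sigma.mk.inj h1).2
      have h4 : Fin.castLE _ s = Fin.castLE _ s' := eq_of_heq (Sigma.mk.inj h2).2
      rw [Fin.castLE_inj] at h3 h4
      rw [h3, h4]
  have key₁ := finrank_add_card_le he.toOrthogonalIdempotents
    (rad_pow_le (φ := φ) le_rfl one_le_two) (hideal le_rfl) (hideal one_le_two)
    (Finset.univ.image f₁) (by
      simp only [Finset.mem_image, Finset.mem_univ, true_and, forall_exists_index,
        forall_apply_eq_imp_iff]
      rintro (⟨⟨g, hg⟩, r⟩ | ⟨⟨g, hg⟩, r⟩)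
      · exact hlink le_rfl (hCl g hg) _ _
      · exact hlink le_rfl (hCl' g hg) _ _)
  -- The links in degree at least two have varying degrees, so the corners are compared with zero
  -- and not with a fixed higher power.
  have key₂ := finrank_add_card_le he.toOrthogonalIdempotents
    (bot_le (a := rad φ ^ 2)) (hideal one_le_two) (by simp)
    (Finset.univ.image f₂) (by
      have aux : ∀ {n i j}, 1 < n → Link φ n i j → ∀ p q,
          ∃ x ∈ rad φ ^ 2, e ⟨i, p⟩ * x * e ⟨j, q⟩ ∉ (⊥ : Submodule k A) := by
        intro n i j hn hl p q
        obtain ⟨x, hx, hx'⟩ := hlink hn.le hl p q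
        refine ⟨x, rad_pow_le one_le_two hn hx, fun h0 => hx' ?_⟩
        rw [(Submodule.mem_bot k).1 h0]
        exact zero_mem _
      simp only [Finset.mem_image, Finset.mem_univ, true_and, forall_exists_index,
        forall_apply_eq_imp_iff]
      rintro (⟨g, hg⟩ | ⟨r, s⟩)
      · exact aux (hm g hg) (hl g hg) _ _
      · exact aux (hn' g₀ hg₀) (hCD g₀ hg₀) _ _)
  have hp : rad φ ^ 1 = rad φ := pow_one _
  rw [Finset.card_image_of_injective _ hf₁, hp] at key₁
  rw [Finset.card_image_of_injective _ hf₂] at key₂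
  simp only [Finset.card_univ, Fintype.card_sum, Fintype.card_prod, Fintype.card_fin,
    finrank_bot] at key₁ key₂
  rw [← finrank_rad_add hφ]
  change _ + _ * Fintype.card G + _ ≤ _
  nlinarith

end DimensionBound

end HopfCoradical

namespace HopfCoradical

/-! ### The radical quotient of a finite-dimensional algebra -/

section Wedderburn

/-- Wedderburn's theorem for the semisimple quotient of a finite-dimensional algebra. -/
theorem exists_wedderburn (k A : Type*) [Field k] [IsAlgClosed k] [Ring A] [Algebra k A]
    [FiniteDimensional k A] :
    ∃ (r : ℕ) (d : Fin r → ℕ) (φ : A →ₐ[k] Π i, Matrix (Fin (d i)) (Fin (d i)) k),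
      (∀ i, 1 ≤ d i) ∧ Function.Surjective φ ∧ ∃ N, rad φ ^ N = ⊥ := by
  have : IsArtinianRing A := IsArtinianRing.of_finite k A
  obtain ⟨r, d, hd, ⟨f⟩⟩ := IsSemisimpleRing.exists_algEquiv_pi_matrix_of_isAlgClosed k
    (A ⧸ Ring.jacobson A)
  refine ⟨r, d, f.toAlgHom.comp (Ideal.Quotient.mkₐ k (Ring.jacobson A)),
    fun i => (hd i).one_le, ?_, ?_⟩
  · exact f.surjective.comp (Ideal.Quotient.mkₐ_surjective k _)
  · obtain ⟨N, hN⟩ := IsSemiprimaryRing.isNilpotent (R := A)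
    have key : ∀ n, ∀ x ∈ rad (f.toAlgHom.comp (Ideal.Quotient.mkₐ k (Ring.jacobson A))) ^ n,
        x ∈ Ring.jacobson A ^ n := by
      intro n
      induction n with
      | zero => intro x _; rw [Submodule.pow_zero, Ideal.one_eq_top]; trivial
      | succ n ih =>
        intro x hx
        rw [pow_succ] at hx
        rw [Submodule.pow_succ]
        refine Submodule.mul_induction_on hx (fun a ha b hb => ?_) fun a b ha hb => add_mem ha hb
        refine Ideal.mul_mem_mul (ih a ha) ?_
        rw [mem_rad] at hb
        have : f (Ideal.Quotient.mk _ b) = 0 := hb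
        rwa [map_eq_zero_iff _ f.injective, Ideal.Quotient.eq_zero_iff_mem] at this
    refine ⟨N, (Submodule.eq_bot_iff _).2 fun x hx => ?_⟩
    have := key N x hx
    rwa [hN] at this

end Wedderburn

/-! ### Contractions and annihilators between a space and its dual -/

section DualAlgebra

open Coalgebra WithConv

variable {k H : Type*} [Field k] [AddCommGroup H] [Module k H]

/-- The contraction `x ⊗ y ↦ a(x) y`. -/
noncomputable def contrL (a : WithConv (H →ₗ[k] k)) : H ⊗[k] H →ₗ[k] H :=
  TensorProduct.lid k H ∘ₗ LinearMap.rTensor H a.ofConv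

/-- The contraction `x ⊗ y ↦ a(y) x`. -/
noncomputable def contrR (a : WithConv (H →ₗ[k] k)) : H ⊗[k] H →ₗ[k] H :=
  TensorProduct.rid k H ∘ₗ LinearMap.lTensor H a.ofConv

@[simp] theorem contrL_tmul (a : WithConv (H →ₗ[k] k)) (x y : H) :
    contrL a (x ⊗ₜ y) = a x • y := by simp [contrL]

@[simp] theorem contrR_tmul (a : WithConv (H →ₗ[k] k)) (x y : H) :
    contrR a (x ⊗ₜ y) = a y • x := by simp [contrR]

theorem apply_contrL (a b : WithConv (H →ₗ[k] k)) (w : H ⊗[k] H) :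
    b (contrL a w) = a (contrR b w) := by
  induction w with
  | zero => simp
  | tmul x y => simp [mul_comm]
  | add x y hx hy => rw [map_add, map_add, map_add, map_add, hx, hy]

theorem contrL_lTensor (a : WithConv (H →ₗ[k] k)) (f : H →ₗ[k] H) (w : H ⊗[k] H) :
    contrL a (LinearMap.lTensor H f w) = f (contrL a w) := by
  induction w with
  | zero => simp
  | tmul x y => simp
  | add x y hx hy => simp only [map_add, hx, hy]

theorem contrR_rTensor (a : WithConv (H →ₗ[k] k)) (f : H →ₗ[k] H) (w : H ⊗[k] H) :
    contrR a (LinearMap.rTensor H f w) = f (contrR a w) := by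
  induction w with
  | zero => simp
  | tmul x y => simp
  | add x y hx hy => simp only [map_add, hx, hy]

theorem contrL_rTensor (a : WithConv (H →ₗ[k] k)) (f : H →ₗ[k] H) (w : H ⊗[k] H) :
    contrL a (LinearMap.rTensor H f w) = contrL (toConv (a.ofConv ∘ₗ f)) w := by
  induction w with
  | zero => simp
  | tmul x y => simp
  | add x y hx hy => simp only [map_add, hx, hy]

theorem contrR_lTensor (a : WithConv (H →ₗ[k] k)) (f : H →ₗ[k] H) (w : H ⊗[k] H) :
    contrR a (LinearMap.lTensor H f w) = contrR (toConv (a.ofConv ∘ₗ f)) w := by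
  induction w with
  | zero => simp
  | tmul x y => simp
  | add x y hx hy => simp only [map_add, hx, hy]

theorem tmul_mem_tens {X Y : Submodule k H} {x y : H} (hx : x ∈ X) (hy : y ∈ Y) :
    x ⊗ₜ[k] y ∈ tens X Y :=
  ⟨⟨x, hx⟩ ⊗ₜ ⟨y, hy⟩, by simp [TensorProduct.mapIncl]⟩

theorem contrL_mem_of_mem_tens {X Y : Submodule k H} {w : H ⊗[k] H} (hw : w ∈ tens X Y)
    (a : WithConv (H →ₗ[k] k)) : contrL a w ∈ Y := by
  obtain ⟨w, rfl⟩ := hw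
  induction w with
  | zero => simp
  | tmul x y => simpa [TensorProduct.mapIncl] using Y.smul_mem _ y.2
  | add x y hx hy => rw [map_add, map_add]; exact add_mem hx hy

theorem contrR_mem_of_mem_tens {X Y : Submodule k H} {w : H ⊗[k] H} (hw : w ∈ tens X Y)
    (a : WithConv (H →ₗ[k] k)) : contrR a w ∈ X := by
  obtain ⟨w, rfl⟩ := hw
  induction w with
  | zero => simp
  | tmul x y => simpa [TensorProduct.mapIncl] using X.smul_mem _ x.2
  | add x y hx hy => rw [map_add, map_add]; exact add_mem hx hy

theorem mem_of_forall_functional {S : Submodule k H} {y : H}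
    (h : ∀ a : WithConv (H →ₗ[k] k), (∀ x ∈ S, a x = 0) → a y = 0) : y ∈ S := by
  by_contra hy
  obtain ⟨f, hf, hS⟩ := Submodule.exists_le_ker_of_notMem hy
  exact hf (h (toConv f) fun x hx => hS hx)

theorem eq_of_forall_functional {x y : H} (h : ∀ a : WithConv (H →ₗ[k] k), a x = a y) :
    x = y := by
  rw [← sub_eq_zero, ← Submodule.mem_bot k]
  exact mem_of_forall_functional fun a _ => by rw [map_sub, h, sub_self]

/-- The elements annihilated by a subspace of the dual. -/
def perp (I : Submodule k (WithConv (H →ₗ[k] k))) : Submodule k H where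
  carrier := {x | ∀ a ∈ I, a x = 0}
  zero_mem' := fun a _ => map_zero _
  add_mem' := fun hx hy a ha => by rw [map_add, hx a ha, hy a ha, add_zero]
  smul_mem' := fun r x hx a ha => by rw [map_smul, hx a ha, smul_zero]

theorem sum_contrR_tmul {κ : Type*} [Fintype κ] (b : Module.Basis κ k H) (w : H ⊗[k] H) :
    ∑ i, contrR (toConv (b.coord i)) w ⊗ₜ[k] b i = w := by
  induction w with
  | zero => simp
  | tmul x y =>
    simp only [contrR_tmul, TensorProduct.smul_tmul, ← TensorProduct.tmul_sum]
    exact congrArg _ (b.sum_repr y)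
  | add x y hx hy =>
    simp only [map_add, TensorProduct.add_tmul, Finset.sum_add_distrib, hx, hy]

variable [FiniteDimensional k H]

theorem tensor_ext {w w' : H ⊗[k] H} (h : ∀ a b : WithConv (H →ₗ[k] k),
    b (contrL a w) = b (contrL a w')) : w = w' := by
  rw [← sum_contrR_tmul (Module.finBasis k H) w, ← sum_contrR_tmul (Module.finBasis k H) w']
  refine Finset.sum_congr rfl fun i _ => ?_
  congr 1
  refine eq_of_forall_functional (k := k) fun a => ?_
  rw [← apply_contrL, ← apply_contrL, h]

/-- `X ⊗ Y` is the intersection of `X ⊗ H` and `H ⊗ Y`. In this form conditions on tensors become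
conditions on functionals, that is, on the dual algebra. -/
theorem mem_tens_iff {X Y : Submodule k H} {w : H ⊗[k] H} :
    w ∈ tens X Y ↔ (∀ a, contrL a w ∈ Y) ∧ ∀ a, contrR a w ∈ X := by
  refine ⟨fun h => ⟨contrL_mem_of_mem_tens h, contrR_mem_of_mem_tens h⟩, fun ⟨hY, hX⟩ => ?_⟩
  obtain ⟨Q, hQ⟩ := Y.exists_isCompl
  let q : H →ₗ[k] H := Y.projection Q hQ
  have hq : ∀ y ∈ Y, q y = y := fun y hy => Submodule.projection_apply_of_mem_left hQ hy
  have hqY : ∀ y, q y ∈ Y := Submodule.projection_apply_mem hQ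
  have h1 : LinearMap.lTensor H q w = w := tensor_ext fun a b => by
    rw [contrL_lTensor, hq _ (hY a)]
  rw [← h1, ← sum_contrR_tmul (Module.finBasis k H) w, map_sum]
  exact sum_mem fun i _ => by
    rw [LinearMap.lTensor_tmul]
    exact tmul_mem_tens (hX _) (hqY _)

instance : FiniteDimensional k (WithConv (H →ₗ[k] k)) :=
  Module.Finite.equiv (WithConv.linearEquiv k (H →ₗ[k] k)).symm

theorem exists_eval (F : WithConv (H →ₗ[k] k) →ₗ[k] k) : ∃ x : H, ∀ a, F a = a x := by
  obtain ⟨x, hx⟩ := (Module.evalEquiv k H).surjective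
    (F ∘ₗ (WithConv.linearEquiv k (H →ₗ[k] k)).symm.toLinearMap)
  exact ⟨x, fun a => (LinearMap.congr_fun hx a.ofConv).symm⟩

theorem exists_eval_ne_zero {I : Submodule k (WithConv (H →ₗ[k] k))} {a : WithConv (H →ₗ[k] k)}
    (ha : a ∉ I) : ∃ x : H, (∀ b ∈ I, b x = 0) ∧ a x ≠ 0 := by
  obtain ⟨f, hf, hI⟩ := Submodule.exists_le_ker_of_notMem ha
  obtain ⟨x, hx⟩ := exists_eval f
  exact ⟨x, fun b hb => by rw [← hx]; exact hI hb, by rwa [← hx]⟩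

theorem finrank_add_finrank_perp (I : Submodule k (WithConv (H →ₗ[k] k))) :
    Module.finrank k I + Module.finrank k (perp I) = Module.finrank k H := by
  let L := WithConv.linearEquiv k (H →ₗ[k] k)
  have h := Subspace.finrank_add_finrank_dualCoannihilator_eq
    (I.map L.toLinearMap : Submodule k (Module.Dual k H))
  rw [show Module.finrank k (I.map L.toLinearMap) = Module.finrank k I from
    L.finrank_map_eq I] at h
  have h2 : perp I = (I.map L.toLinearMap : Submodule k (Module.Dual k H)).dualCoannihilator := by
    ext x
    rw [Submodule.mem_dualCoannihilator]
    constructor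
    · rintro hx _ ⟨a, ha, rfl⟩
      exact hx a ha
    · exact fun hx a ha => hx _ ⟨a, ha, rfl⟩
  rw [h2]
  exact h

end DualAlgebra

end HopfCoradical

namespace HopfCoradical

open Coalgebra WithConv

section MatrixUnit

theorem matrix_exists_sum_mul_mul_eq_one {k : Type*} [Field k] {m : ℕ}
    {X : Matrix (Fin m) (Fin m) k} (hX : X ≠ 0) :
    ∃ u v : Fin m → Matrix (Fin m) (Fin m) k, ∑ r, u r * X * v r = 1 := by
  obtain ⟨b, c, hbc⟩ : ∃ b c, X b c ≠ 0 := by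
    by_contra! h; exact hX (Matrix.ext h)
  refine ⟨fun r => Matrix.single r b (X b c)⁻¹, fun r => Matrix.single c r 1, ?_⟩
  rw [← Matrix.sum_single_one]
  refine Finset.sum_congr rfl fun r _ => ?_
  rw [Matrix.single_mul_mul_single, inv_mul_cancel₀ hbc, one_mul]

end MatrixUnit

/-! ### Subcoalgebras and ideals of the dual algebra; the coradical -/

section DualCoalgebra

variable {k H : Type*} [Field k] [AddCommGroup H] [Module k H]

theorem conv_sum_apply {κ : Type*} (s : Finset κ) (f : κ → WithConv (H →ₗ[k] k)) (x : H) :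
    (∑ i ∈ s, f i) x = ∑ i ∈ s, f i x := by
  change (WithConv.linearEquiv k (H →ₗ[k] k) (∑ i ∈ s, f i)) x = _
  rw [map_sum, LinearMap.sum_apply]
  rfl

variable [Coalgebra k H]

theorem mul_apply_contrL (a b : WithConv (H →ₗ[k] k)) (x : H) :
    (a * b) x = b (contrL a (comul x)) := by
  change LinearMap.mul' k k (TensorProduct.map a.ofConv b.ofConv (comul x)) = _
  generalize (comul x : H ⊗[k] H) = w
  induction w with
  | zero => simp
  | tmul x y => simp
  | add x y hx hy => simp only [map_add, hx, hy]

theorem mul_apply_contrR (a b : WithConv (H →ₗ[k] k)) (x : H) :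
    (a * b) x = a (contrR b (comul x)) := by
  rw [mul_apply_contrL, apply_contrL]

theorem one_apply_counit (x : H) : (1 : WithConv (H →ₗ[k] k)) x = counit (R := k) x := rfl

theorem contrL_comul_contrL (a b : WithConv (H →ₗ[k] k)) (x : H) :
    contrL b (comul (contrL a (comul x))) = contrL (a * b) (comul x) :=
  eq_of_forall_functional (k := k) fun c => by
    rw [← mul_apply_contrL, ← mul_apply_contrL, ← mul_apply_contrL, mul_assoc]

theorem contrR_comul_contrR (a b : WithConv (H →ₗ[k] k)) (x : H) :
    contrR a (comul (contrR b (comul x))) = contrR (a * b) (comul x) :=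
  eq_of_forall_functional (k := k) fun c => by
    rw [← mul_apply_contrR, ← mul_apply_contrR, ← mul_apply_contrR, mul_assoc]

@[simp] theorem contrL_one_comul (x : H) : contrL (1 : WithConv (H →ₗ[k] k)) (comul x) = x :=
  eq_of_forall_functional (k := k) fun c => by rw [← mul_apply_contrL, one_mul]

@[simp] theorem contrR_one_comul (x : H) : contrR (1 : WithConv (H →ₗ[k] k)) (comul x) = x :=
  eq_of_forall_functional (k := k) fun c => by rw [← mul_apply_contrR, mul_one]

/-- A grouplike element is a character of the dual algebra. -/
theorem isGroupLikeElem_mul_apply {g : H} (hg : IsGroupLikeElem k g) (a b : WithConv (H →ₗ[k] k)) :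
    (a * b) g = a g * b g := by
  rw [mul_apply_contrL, hg.comul_eq_tmul_self, contrL_tmul, map_smul, smul_eq_mul]

variable {ι : Type*} {d : ι → ℕ}
  {φ : WithConv (H →ₗ[k] k) →ₐ[k] Π i, Matrix (Fin (d i)) (Fin (d i)) k}

/-- The subcoalgebra of matrix coefficients of a block of the dual algebra. -/
noncomputable def blockCoalgebra
    (φ : WithConv (H →ₗ[k] k) →ₐ[k] Π i, Matrix (Fin (d i)) (Fin (d i)) k) (i : ι) :
    Submodule k H :=
  perp (LinearMap.ker (LinearMap.proj i ∘ₗ φ.toLinearMap))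

theorem mem_blockCoalgebra {i : ι} {x : H} :
    x ∈ blockCoalgebra φ i ↔ ∀ a : WithConv (H →ₗ[k] k), φ a i = 0 → a x = 0 := Iff.rfl

variable [FiniteDimensional k H]

theorem isSubcoalgebra_iff {C : Submodule k H} :
    IsSubcoalgebra C ↔ ∀ x ∈ C, ∀ a : WithConv (H →ₗ[k] k),
      contrL a (comul x) ∈ C ∧ contrR a (comul x) ∈ C := by
  rw [IsSubcoalgebra, Submodule.map_le_iff_le_comap]
  constructor
  · exact fun h x hx a => ⟨(mem_tens_iff.1 (h hx)).1 a, (mem_tens_iff.1 (h hx)).2 a⟩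
  · exact fun h x hx => mem_tens_iff.2 ⟨fun a => (h x hx a).1, fun a => (h x hx a).2⟩

theorem isGroupLikeElem_of_mul_apply {g : H}
    (h1 : (1 : WithConv (H →ₗ[k] k)) g = 1)
    (hg : ∀ a b : WithConv (H →ₗ[k] k), (a * b) g = a g * b g) : IsGroupLikeElem k g where
  counit_eq_one := h1
  comul_eq_tmul_self := tensor_ext fun a b => by
    rw [← mul_apply_contrL, hg, contrL_tmul, map_smul, smul_eq_mul]

section Block


theorem isSubcoalgebra_blockCoalgebra (i : ι) : IsSubcoalgebra (blockCoalgebra φ i) := by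
  refine isSubcoalgebra_iff.2 fun x hx a => ⟨fun b hb => ?_, fun b hb => ?_⟩
  · rw [← mul_apply_contrL]
    refine hx _ ?_
    have hb : φ b i = 0 := hb
    change φ (a * b) i = 0
    rw [map_mul, Pi.mul_apply, hb, mul_zero]
  · rw [← mul_apply_contrR]
    refine hx _ ?_
    have hb : φ b i = 0 := hb
    change φ (b * a) i = 0
    rw [map_mul, Pi.mul_apply, hb, zero_mul]

theorem perp_rad_isSubcoalgebra : IsSubcoalgebra (perp (rad φ)) := by
  refine isSubcoalgebra_iff.2 fun x hx a => ⟨fun b hb => ?_, fun b hb => ?_⟩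
  · rw [← mul_apply_contrL]
    exact hx _ (by rw [mem_rad] at hb ⊢; rw [map_mul, hb, mul_zero])
  · rw [← mul_apply_contrR]
    exact hx _ (by rw [mem_rad] at hb ⊢; rw [map_mul, hb, zero_mul])

/-- By simplicity `B` either lies in the annihilator of `J` or meets it in zero. In the second case
no nonzero element of `B` is killed by `J`, so arbitrarily long products from `J` act nontrivially,
against nilpotency. -/
theorem le_perp_rad {N : ℕ} (hN : rad φ ^ N = ⊥) {B : Submodule k H}
    (hB : IsSimpleSubcoalgebra B) : B ≤ perp (rad φ) := by
  have hB' := isSubcoalgebra_iff.1 hB.1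
  have hp := isSubcoalgebra_iff.1 (perp_rad_isSubcoalgebra (φ := φ))
  rcases hB.2.2 (B ⊓ perp (rad φ)) (isSubcoalgebra_iff.2 fun x hx a =>
    ⟨⟨(hB' x hx.1 a).1, (hp x hx.2 a).1⟩, ⟨(hB' x hx.1 a).2, (hp x hx.2 a).2⟩⟩) inf_le_left
    with h | h
  · exfalso
    have step : ∀ x ∈ B, x ≠ 0 → ∃ a ∈ rad φ, contrL a (comul x) ≠ 0 := by
      intro x hx hx0
      by_contra! hcon
      refine hx0 ((Submodule.eq_bot_iff _).1 h x ⟨hx, fun a ha => ?_⟩)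
      rw [← mul_one a, mul_apply_contrL, hcon a ha, map_zero]
    obtain ⟨x, hx, hx0⟩ := (Submodule.ne_bot_iff _).1 hB.2.1
    have key : ∀ n, ∃ a ∈ rad φ ^ (n + 1), contrL a (comul x) ≠ 0 := by
      intro n
      induction n with
      | zero => simpa using step x hx hx0
      | succ n ih =>
        obtain ⟨a, ha, ha0⟩ := ih
        obtain ⟨b, hb, hb0⟩ := step _ (hB' x hx a).1 ha0
        refine ⟨a * b, ?_, by rwa [← contrL_comul_contrL]⟩
        rw [pow_succ _ (n + 1)]
        exact Submodule.mul_mem_mul ha hb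
    obtain ⟨a, ha, ha0⟩ := key N
    rw [pow_succ, hN, Submodule.bot_mul, Submodule.mem_bot] at ha
    refine ha0 (eq_of_forall_functional (k := k) fun c => ?_)
    rw [← mul_apply_contrL, ha, zero_mul, map_zero]
    rfl
  · rw [← h]; exact inf_le_right

variable [DecidableEq ι]

theorem finrank_blockCoalgebra (hφ : Function.Surjective φ) (i : ι) :
    Module.finrank k (blockCoalgebra φ i) = d i ^ 2 := by
  have h1 := finrank_add_finrank_perp (LinearMap.ker (LinearMap.proj i ∘ₗ φ.toLinearMap))
  have h2 := LinearMap.finrank_range_add_finrank_ker (LinearMap.proj i ∘ₗ φ.toLinearMap)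
  rw [LinearMap.range_eq_top.2, finrank_top] at h2
  · have h3 : Module.finrank k (WithConv (H →ₗ[k] k)) = Module.finrank k H :=
      (WithConv.linearEquiv k (H →ₗ[k] k)).finrank_eq.trans Subspace.dual_finrank_eq
    simp only [Module.finrank_matrix, Fintype.card_fin, Module.finrank_self, mul_one] at h2
    rw [blockCoalgebra, pow_two]
    omega
  · intro M
    obtain ⟨x, hx⟩ := hφ (Pi.single i M)
    exact ⟨x, by simp [hx]⟩

/-- If `B` is a proper subcoalgebra, some functional vanishing on `B` is nonzero in block `i`. The
ideal it generates contains an identity of the simple block and still annihilates `B`, so `B` is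
zero. -/
theorem isSimpleSubcoalgebra_blockCoalgebra (hφ : Function.Surjective φ) {i : ι} (hi : 1 ≤ d i) :
    IsSimpleSubcoalgebra (blockCoalgebra φ i) := by
  refine ⟨isSubcoalgebra_blockCoalgebra i, fun h => ?_, fun B hB hBi => ?_⟩
  · have := finrank_blockCoalgebra hφ i
    rw [h, finrank_bot] at this
    have := pow_pos (Nat.lt_of_succ_le hi) 2
    omega
  · by_contra! hcon
    refine hcon.2 (le_antisymm hBi fun y hy => mem_of_forall_functional fun a ha => hy a ?_)
    by_contra h0
    refine hcon.1 ((Submodule.eq_bot_iff _).2 fun x hx => ?_)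
    obtain ⟨u, v, huv⟩ := matrix_exists_sum_mul_mul_eq_one (X := φ a i) h0
    choose u' hu' using fun r => hφ (Pi.single i (u r))
    choose v' hv' using fun r => hφ (Pi.single i (v r))
    refine eq_of_forall_functional (k := k) fun c => ?_
    have h1 : (c * (1 - ∑ r, u' r * a * v' r)) x = 0 := by
      refine hBi hx _ ?_
      change φ _ i = 0
      rw [map_mul, map_sub, map_one, map_sum]
      simp only [map_mul, hu', hv', Pi.mul_apply, Pi.sub_apply, Finset.sum_apply, Pi.single_eq_same,
        huv, Pi.one_apply, sub_self, mul_zero]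
    have h2 : (∑ r, c * (u' r * a * v' r)) x = 0 := by
      rw [conv_sum_apply]
      refine Finset.sum_eq_zero fun r _ => ?_
      rw [← mul_assoc, ← mul_assoc, mul_apply_contrR, mul_apply_contrL]
      exact ha _ (isSubcoalgebra_iff.1 hB _ (isSubcoalgebra_iff.1 hB _ hx _).2 _).1
    rw [mul_sub, mul_one, Finset.mul_sum] at h1
    rw [map_zero, ← h1]
    change _ = c x - (∑ r, c * (u' r * a * v' r)) x
    rw [h2, sub_zero]

variable [Fintype ι]

/-- Lifted block identities sum to one, so contracting with them splits an element annihilated by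
`J` into pieces lying in the block coalgebras. -/
theorem coradical_eq_perp_rad (hd : ∀ i, 1 ≤ d i) (hφ : Function.Surjective φ) {N : ℕ}
    (hN : rad φ ^ N = ⊥) : coradical k H = perp (rad φ) := by
  refine le_antisymm (sSup_le fun B hB => le_perp_rad hN hB) fun x hx => ?_
  obtain ⟨e, he, hφe⟩ := exists_block_idempotents hφ hN
  have h1 : x = ∑ i, contrL (e i) (comul x) := by
    refine eq_of_forall_functional (k := k) fun c => ?_
    rw [map_sum]
    simp only [← mul_apply_contrL]
    rw [← conv_sum_apply, ← Finset.sum_mul, he.complete, one_mul]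
  rw [h1]
  refine sum_mem fun i _ => ?_
  refine le_sSup (a := blockCoalgebra φ i) (isSimpleSubcoalgebra_blockCoalgebra hφ (hd i))
    fun b hb => ?_
  rw [← mul_apply_contrL]
  exact hx _ ((supportedAt_of_eq_single (hφe i)).mem_rad_mul hb)

end Block

end DualCoalgebra

end HopfCoradical

namespace HopfCoradical

open Coalgebra WithConv

/-! ### The spaces `P_n` in terms of powers of the radical -/

section Filtration

variable {k H : Type*} [Field k] [AddCommGroup H] [Module k H]

theorem tens_le_ker_contrL {X Y : Submodule k H} {a : WithConv (H →ₗ[k] k)}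
    (ha : ∀ x ∈ X, a x = 0) : tens X Y ≤ LinearMap.ker (contrL a) := by
  rintro _ ⟨w, rfl⟩
  induction w with
  | zero => simp
  | tmul x y => simp [TensorProduct.mapIncl, ha x.1 x.2]
  | add x y hx hy => rw [map_add]; exact add_mem hx hy

variable [Coalgebra k H]

/-- The endomorphism of the dual algebra given by a coalgebra endomorphism. -/
noncomputable def dualMap (π : H →ₗc[k] H) : WithConv (H →ₗ[k] k) →ₗ[k] WithConv (H →ₗ[k] k) where
  toFun a := toConv (a.ofConv ∘ₗ (π : H →ₗ[k] H))
  map_add' _ _ := rfl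
  map_smul' _ _ := rfl

variable {π : H →ₗc[k] H}

theorem dualMap_apply (a : WithConv (H →ₗ[k] k)) (x : H) : dualMap π a x = a (π x) := rfl

theorem dualMap_mul (a b : WithConv (H →ₗ[k] k)) :
    dualMap π (a * b) = dualMap π a * dualMap π b :=
  WithConv.ext (LinearMap.convMul_comp_coalgHom_distrib a b π)

theorem dualMap_one : dualMap π (1 : WithConv (H →ₗ[k] k)) = 1 := by
  refine WithConv.ext (LinearMap.ext fun x => ?_)
  change counit (R := k) (π x) = counit (R := k) x
  simp

theorem IsCoradicalProjection.map_map (hπ : IsCoradicalProjection π) (x : H) :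
    π (π x) = π x :=
  hπ.apply_eq _ (hπ.range_eq ▸ ⟨x, rfl⟩)

theorem IsCoradicalProjection.dualMap_dualMap (hπ : IsCoradicalProjection π)
    (a : WithConv (H →ₗ[k] k)) : dualMap π (dualMap π a) = dualMap π a :=
  WithConv.ext (LinearMap.ext fun x => congrArg a.ofConv (hπ.map_map x))

/-- The bridge between the definition of `P_n` and powers of `J`: up to a term seeing only `π x`,
the defining tensor pairs with `a ⊗ b` through the product of the components `a - dualMap π a` and
`b - dualMap π b`, which lie in `J` when `π` is a coradical projection. -/
theorem apply_contrL_comul_sub (a b : WithConv (H →ₗ[k] k)) (x : H) :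
    b (contrL a ((comul - rhoL π - rhoR π : H →ₗ[k] H ⊗[k] H) x)) =
      ((a - dualMap π a) * (b - dualMap π b)) x - (dualMap π (a * b)) x := by
  have h1 : b (contrL a (rhoL π x)) = (dualMap π a * b) x := by
    rw [mul_apply_contrL, rhoL, LinearMap.comp_apply, contrL_rTensor]
    rfl
  have h2 : b (contrL a (rhoR π x)) = (a * dualMap π b) x := by
    rw [mul_apply_contrL, rhoR, LinearMap.comp_apply, contrL_lTensor]
    rfl
  have h3 : (a - dualMap π a) * (b - dualMap π b) - dualMap π (a * b) =
      a * b - dualMap π a * b - a * dualMap π b := by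
    rw [dualMap_mul, sub_mul, mul_sub, mul_sub]; abel
  change _ = ((a - dualMap π a) * (b - dualMap π b) - dualMap π (a * b)) x
  rw [h3]
  change _ = (a * b) x - (dualMap π a * b) x - (a * dualMap π b) x
  rw [LinearMap.sub_apply, LinearMap.sub_apply, map_sub, map_sub, map_sub, map_sub, h1, h2,
    mul_apply_contrL a b]

variable [FiniteDimensional k H] {ι : Type*} {d : ι → ℕ}
  {φ : WithConv (H →ₗ[k] k) →ₐ[k] Π i, Matrix (Fin (d i)) (Fin (d i)) k}

theorem IsCoradicalProjection.dualMap_eq_zero_iff (hπ : IsCoradicalProjection π)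
    (hc : coradical k H = perp (rad φ)) {a : WithConv (H →ₗ[k] k)} :
    dualMap π a = 0 ↔ a ∈ rad φ := by
  constructor
  · intro h
    by_contra ha
    obtain ⟨x, hx, hax⟩ := exists_eval_ne_zero ha
    have hx' : x ∈ coradical k H := hc ▸ hx
    refine hax ?_
    rw [← hπ.apply_eq x hx', ← dualMap_apply, h]
    rfl
  · intro ha
    refine WithConv.ext (LinearMap.ext fun x => ?_)
    have : π x ∈ coradical k H := hπ.range_eq ▸ ⟨x, rfl⟩
    rw [hc] at this
    exact this a ha

theorem IsCoradicalProjection.sub_mem_rad (hπ : IsCoradicalProjection π)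
    (hc : coradical k H = perp (rad φ)) (a : WithConv (H →ₗ[k] k)) :
    a - dualMap π a ∈ rad φ := by
  rw [← hπ.dualMap_eq_zero_iff hc, map_sub, hπ.dualMap_dualMap, sub_self]

theorem IsCoradicalProjection.dualMap_eq_iff (hπ : IsCoradicalProjection π)
    (hc : coradical k H = perp (rad φ)) {a b : WithConv (H →ₗ[k] k)} :
    dualMap π a = dualMap π b ↔ φ a = φ b := by
  rw [← sub_eq_zero, ← map_sub, hπ.dualMap_eq_zero_iff hc, mem_rad, map_sub, sub_eq_zero]

theorem IsCoradicalProjection.map_dualMap (hπ : IsCoradicalProjection π)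
    (hc : coradical k H = perp (rad φ)) (a : WithConv (H →ₗ[k] k)) : φ (dualMap π a) = φ a := by
  rw [← hπ.dualMap_eq_iff hc, hπ.dualMap_dualMap]

/-- The space `P_n` is the intersection of `ker π` with the `n`-th term of the coradical
filtration. -/
theorem IsCoradicalProjection.mem_P_iff (hπ : IsCoradicalProjection π)
    (hc : coradical k H = perp (rad φ)) (n : ℕ) (x : H) :
    x ∈ P π n ↔ π x = 0 ∧ x ∈ perp (rad φ ^ (n + 1)) := by
  induction n using Nat.strong_induction_on generalizing x with
  | _ n ih =>
  cases n with
  | zero =>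
    rw [P, Submodule.mem_bot]
    refine ⟨fun h => by simp [h], fun ⟨h1, h2⟩ => eq_of_forall_functional (k := k) fun a => ?_⟩
    have := h2 (a - dualMap π a) (by simpa using hπ.sub_mem_rad hc a)
    change a x - a (π x) = 0 at this
    rwa [h1, map_zero, sub_zero, ← map_zero a.ofConv] at this
  | succ n =>
    rw [P, Submodule.mem_comap]
    have hK : ∀ m ≤ n, ∀ y ∈ P π m, π y = 0 := fun m hm y hy => ((ih m (by omega) y).1 hy).1
    set w := (comul - rhoL π - rhoR π : H →ₗ[k] H ⊗[k] H) x with hw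
    constructor
    · intro h
      have hker : ∀ a : WithConv (H →ₗ[k] k), (∀ m ≤ n, ∀ y ∈ P π m, a y = 0) → contrL a w = 0 :=
        fun a ha => (iSup_le (a := LinearMap.ker (contrL a)) fun i : Fin n =>
          tens_le_ker_contrL (ha (i + 1) (by omega))) h
      have hx : π x = 0 := by
        refine eq_of_forall_functional (k := k) fun a => ?_
        -- Pairing with `dualMap π a` and the unit leaves only the correction term `-a (π x)`.
        have h1 := hker (dualMap π a) fun m hm y hy => by
          rw [dualMap_apply, hK m hm y hy, map_zero]
        have h2 := apply_contrL_comul_sub (π := π) (dualMap π a) 1 x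
        rw [← hw, h1, map_zero, hπ.dualMap_dualMap, sub_self, zero_mul, mul_one,
          hπ.dualMap_dualMap] at h2
        change 0 = 0 - a (π x) at h2
        rw [map_zero]
        linear_combination h2
      refine ⟨hx, ?_⟩
      intro a ha
      rw [pow_succ] at ha
      refine Submodule.mul_induction_on ha (fun a ha b hb => ?_) fun a b ha hb => ?_
      · have h1 := hker a fun m hm y hy =>
          ((ih m (by omega) y).1 hy).2 a (rad_pow_le (by omega) (by omega) ha)
        have h2 := apply_contrL_comul_sub (π := π) a b x
        rw [← hw, h1, map_zero, (hπ.dualMap_eq_zero_iff hc).2 (rad_pow_le_rad (by omega) ha),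
          (hπ.dualMap_eq_zero_iff hc).2 hb, sub_zero, sub_zero, dualMap_apply, hx, map_zero,
          sub_zero] at h2
        exact h2.symm
      · change a x + b x = 0
        rw [ha, hb, add_zero]
    · rintro ⟨hx, hxr⟩
      have hcon : ∀ a b : WithConv (H →ₗ[k] k), b (contrL a w) =
          ((a - dualMap π a) * (b - dualMap π b)) x := fun a b => by
        rw [hw, apply_contrL_comul_sub, dualMap_apply, hx, map_zero, sub_zero]
      -- Dual form of the induction hypothesis: any `y` annihilated by `J ^ (m + 1)` yields the
      -- element `y - π y` of `P π m`.
      have hann : ∀ m ≤ n, ∀ a : WithConv (H →ₗ[k] k), (∀ y ∈ P π m, a y = 0) →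
          a - dualMap π a ∈ rad φ ^ (m + 1) := by
        intro m hm a ha
        by_contra hcontra
        obtain ⟨y, hy, hay⟩ := exists_eval_ne_zero hcontra
        refine hay ?_
        change a y - a (π y) = 0
        rw [← map_sub]
        refine ha _ ((ih m (by omega) _).2 ⟨?_, fun c hc' => ?_⟩)
        · rw [map_sub, hπ.map_map, sub_self]
        · rw [map_sub, hy c hc', ← dualMap_apply,
            (hπ.dualMap_eq_zero_iff hc).2 (rad_pow_le_rad (by omega) hc')]
          exact sub_zero _
      have hmono : ∀ m < n, P π m ≤ P π (m + 1) := fun m hm y hy => by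
        rw [ih m (by omega)] at hy
        rw [ih (m + 1) (by omega)]
        exact ⟨hy.1, fun a ha => hy.2 a (rad_pow_le (by omega) (by omega) ha)⟩
      choose Q hQ using fun m => (P π m).exists_isCompl
      -- Projections onto the growing spaces `P π m` split the first tensor leg by a telescoping sum
      -- from `r 0 = 0` to `r n`. The latter fixes `w`, because functionals vanishing on `P π n`
      -- only contribute through `J ^ (n + 1) * J`, which kills `x`.
      let r : ℕ → H →ₗ[k] H := fun m => (P π m).projection (Q m) (hQ m)
      have hr : ∀ m, ∀ y ∈ P π m, r m y = y := fun m y hy =>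
        Submodule.projection_apply_of_mem_left (hQ m) hy
      have hrP : ∀ m y, r m y ∈ P π m := fun m => Submodule.projection_apply_mem (hQ m)
      have hr0 : r 0 = 0 := LinearMap.ext fun y => by
        have := hrP 0 y
        rwa [P, Submodule.mem_bot] at this
      have htop : LinearMap.rTensor H (r n) w = w := by
        refine tensor_ext fun a b => ?_
        rw [contrL_rTensor, ← sub_eq_zero, hcon, hcon]
        have h1 := hann n le_rfl (toConv (a.ofConv ∘ₗ r n) - a) fun y hy => by
          change a (r n y) - a y = 0
          rw [hr n y hy, sub_self]
        have h2 := hxr _ (mul_mem_rad_pow_add h1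
          (show b - dualMap π b ∈ rad φ ^ 1 by simpa using hπ.sub_mem_rad hc b))
        rw [map_sub, sub_sub_sub_comm, sub_mul] at h2
        exact h2
      have hsum : w = ∑ i : Fin n, LinearMap.rTensor H (r (i + 1) - r i) w := by
        rw [← LinearMap.sum_apply, Fin.sum_univ_eq_sum_range
          (fun i => LinearMap.rTensor H (r (i + 1) - r i)) n]
        simp only [LinearMap.rTensor_sub]
        rw [Finset.sum_range_sub (fun i => LinearMap.rTensor H (r i)), hr0,
          LinearMap.rTensor_zero, sub_zero, htop]
      rw [hsum]
      refine sum_mem fun i _ => Submodule.mem_iSup_of_mem i (mem_tens_iff.2 ⟨fun a => ?_,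
        fun a => ?_⟩)
      · rw [contrL_rTensor]
        -- `a'` vanishes on `P π i`, so it contributes a factor in `J ^ (i + 1)`. Against `J ^ (n -
        -- i + 1)` this lands in `J ^ (n + 2)`, which kills `x`; hence the second leg lies in `P π
        -- (n - i)`.
        set a' : WithConv (H →ₗ[k] k) := toConv (a.ofConv ∘ₗ (r (i + 1) - r i)) with ha'
        have h1 := hann i i.2.le a' fun y hy => by
          change a (r (i + 1) y - r i y) = 0
          rw [hr _ y hy, hr _ y (hmono i i.2 hy), sub_self, map_zero]
        refine (ih (n - i) (by omega) _).2 ⟨eq_of_forall_functional (k := k) fun c => ?_,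
          fun c hc' => ?_⟩
        · rw [← dualMap_apply, hcon, hπ.dualMap_dualMap, sub_self, mul_zero, map_zero]
          rfl
        · rw [hcon, (hπ.dualMap_eq_zero_iff hc).2 (rad_pow_le_rad (by omega) hc'), sub_zero]
          have := mul_mem_rad_pow_add h1 hc'
          rw [show (i : ℕ) + 1 + (n - i + 1) = n + 1 + 1 by omega] at this
          exact hxr _ this
      · rw [contrR_rTensor]
        exact sub_mem (hrP _ _) (hmono i i.2 (hrP _ _))

end Filtration

end HopfCoradical

namespace HopfCoradical

open Coalgebra WithConv

/-! ### Simple sub-bicomodules; links give nondegenerate components -/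

section Isotypic

variable {k H : Type*} [Field k] [AddCommGroup H] [Module k H] [Coalgebra k H]

/-- The functional `c ↦ (l * c * r) z` on the dual algebra, as an element. -/
noncomputable def biact (l r : WithConv (H →ₗ[k] k)) : H →ₗ[k] H :=
  contrL l ∘ₗ comul ∘ₗ contrR r ∘ₗ comul

theorem apply_biact (l r c : WithConv (H →ₗ[k] k)) (z : H) :
    c (biact l r z) = (l * c * r) z := by
  rw [mul_apply_contrR, mul_apply_contrL]
  rfl

theorem biact_biact (l r l' r' : WithConv (H →ₗ[k] k)) (z : H) :
    biact l r (biact l' r' z) = biact (l' * l) (r * r') z :=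
  eq_of_forall_functional (k := k) fun c => by
    simp only [apply_biact, mul_assoc]

theorem biact_one_right (l : WithConv (H →ₗ[k] k)) (z : H) :
    biact l 1 z = contrL l (comul z) := by
  simp [biact]

theorem biact_one_left (r : WithConv (H →ₗ[k] k)) (z : H) :
    biact 1 r z = contrR r (comul z) := by
  simp [biact]

theorem contrL_rhoL (π : H →ₗc[k] H) (a : WithConv (H →ₗ[k] k)) (z : H) :
    contrL a (rhoL π z) = biact (dualMap π a) 1 z := by
  rw [rhoL, LinearMap.comp_apply, contrL_rTensor, biact_one_right]
  rfl

theorem contrR_rhoL (π : H →ₗc[k] H) (a : WithConv (H →ₗ[k] k)) (z : H) :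
    contrR a (rhoL π z) = π (biact 1 a z) := by
  rw [rhoL, LinearMap.comp_apply, contrR_rTensor, biact_one_left]
  rfl

theorem contrR_rhoR (π : H →ₗc[k] H) (a : WithConv (H →ₗ[k] k)) (z : H) :
    contrR a (rhoR π z) = biact 1 (dualMap π a) z := by
  rw [rhoR, LinearMap.comp_apply, contrR_lTensor, biact_one_left]
  rfl

theorem contrL_rhoR (π : H →ₗc[k] H) (a : WithConv (H →ₗ[k] k)) (z : H) :
    contrL a (rhoR π z) = π (biact a 1 z) := by
  rw [rhoR, LinearMap.comp_apply, contrL_lTensor, biact_one_right]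
  rfl

variable [FiniteDimensional k H] {π : H →ₗc[k] H}

theorem hasCoefficients_iff {X Y S : Submodule k H} :
    HasCoefficients π X Y S ↔ ∀ z ∈ S, ∀ a : WithConv (H →ₗ[k] k),
      (biact (dualMap π a) 1 z ∈ S ∧ biact 1 (dualMap π a) z ∈ S) ∧
      π (biact 1 a z) ∈ X ∧ π (biact a 1 z) ∈ Y := by
  simp only [HasCoefficients, Submodule.map_le_iff_le_comap]
  constructor
  · rintro ⟨h1, h2⟩ z hz a
    rw [← contrL_rhoL, ← contrR_rhoL, ← contrL_rhoR, ← contrR_rhoR]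
    exact ⟨⟨(mem_tens_iff.1 (h1 hz)).1 a, (mem_tens_iff.1 (h2 hz)).2 a⟩,
      (mem_tens_iff.1 (h1 hz)).2 a, (mem_tens_iff.1 (h2 hz)).1 a⟩
  · intro h
    constructor
    · intro z hz
      refine mem_tens_iff.2 ⟨fun a => ?_, fun a => ?_⟩
      · rw [contrL_rhoL]; exact (h z hz a).1.1
      · rw [contrR_rhoL]; exact (h z hz a).2.1
    · intro z hz
      refine mem_tens_iff.2 ⟨fun a => ?_, fun a => ?_⟩
      · rw [contrL_rhoR]; exact (h z hz a).2.2
      · rw [contrR_rhoR]; exact (h z hz a).1.2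

theorem IsSubBicomodule.biact_mem {S : Submodule k H} (h : IsSubBicomodule π S) {z : H}
    (hz : z ∈ S) (a b : WithConv (H →ₗ[k] k)) : biact (dualMap π a) (dualMap π b) z ∈ S := by
  have h' := hasCoefficients_iff.1 h
  have := (h' _ (h' z hz a).1.1 b).1.2
  rwa [biact_biact, mul_one, mul_one] at this

variable {ι : Type*} {d : ι → ℕ}
  {φ : WithConv (H →ₗ[k] k) →ₐ[k] Π i, Matrix (Fin (d i)) (Fin (d i)) k}

theorem IsCoradicalProjection.biact_mem_P (hπ : IsCoradicalProjection π)
    (hc : coradical k H = perp (rad φ)) {n : ℕ} {x : H} (hx : x ∈ P π n)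
    (a b : WithConv (H →ₗ[k] k)) : biact (dualMap π a) (dualMap π b) x ∈ P π n := by
  rw [hπ.mem_P_iff hc] at hx ⊢
  refine ⟨eq_of_forall_functional (k := k) fun c => ?_, fun c hc' => ?_⟩
  · rw [← dualMap_apply, apply_biact, ← dualMap_mul, ← dualMap_mul, dualMap_apply, hx.1, map_zero,
      map_zero]
  · rw [apply_biact]
    exact hx.2 _ (mul_mem_rad_pow_right (by omega) _ (mul_mem_rad_pow_left (by omega) _ hc'))

variable [DecidableEq ι]

/-- The simple sub-bicomodule generated by an element fixed by primitive idempotents. -/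
theorem exists_simple_subBicomodule (hπ : IsCoradicalProjection π)
    (hc : coradical k H = perp (rad φ)) (hφ : Function.Surjective φ) {i j : ι}
    {p : Fin (d i)} {q : Fin (d j)} {e f : WithConv (H →ₗ[k] k)}
    (he : φ e = Pi.single i (Matrix.single p p 1))
    (hf : φ f = Pi.single j (Matrix.single q q 1)) {y z : H}
    (hz0 : z ≠ 0) (hz : z = biact (dualMap π e) (dualMap π f) y) :
    ∃ S : Submodule k H, IsSimpleSubBicomodule π S ∧
      HasCoefficients π (blockCoalgebra φ i) (blockCoalgebra φ j) S ∧ z ∈ S ∧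
      S ≤ Submodule.span k {x | ∃ a b, biact (dualMap π a) (dualMap π b) z = x} := by
  set S := Submodule.span k {x | ∃ a b, biact (dualMap π a) (dualMap π b) z = x} with hS
  have hclosed : ∀ a b, ∀ x ∈ S, biact (dualMap π a) (dualMap π b) x ∈ S := by
    intro a b x hx
    rw [← Submodule.mem_comap]
    refine (Submodule.span_le.2 ?_ : S ≤ _) hx
    rintro _ ⟨a', b', rfl⟩
    refine Submodule.subset_span ⟨a' * a, b * b', ?_⟩
    rw [biact_biact, dualMap_mul, dualMap_mul]
  have hzS : z ∈ S := Submodule.subset_span ⟨1, 1, by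
    rw [dualMap_one, biact_one_left, contrR_one_comul]⟩
  -- The corner cut out by a matrix unit is one-dimensional modulo `J`, so compressing an element of
  -- `S` by `e` and `f` returns a multiple of the generator `z`.
  have hee : ∀ x ∈ S, ∀ a b : WithConv (H →ₗ[k] k),
      biact (dualMap π (a * e)) (dualMap π (f * b)) x ∈ Submodule.span k {z} := by
    intro x hx a b
    rw [← Submodule.mem_comap]
    refine (Submodule.span_le.2 ?_ : S ≤ _) hx
    rintro _ ⟨a', b', rfl⟩
    rw [SetLike.mem_coe, Submodule.mem_comap]
    have key : ∀ (l : ι) (s : Fin (d l)) (c u : WithConv (H →ₗ[k] k)),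
        φ c = Pi.single l (Matrix.single s s 1) →
        dualMap π (c * (u * c)) = (φ u l s s) • dualMap π c := by
      intro l s c u hcl
      rw [← map_smul, hπ.dualMap_eq_iff hc, map_mul, map_mul, hcl, map_smul, hcl]
      funext l'
      by_cases hl : l' = l
      · subst hl
        simp [← mul_assoc, Matrix.single_mul_mul_single]
      · simp [hl]
    rw [hz, biact_biact, biact_biact, ← dualMap_mul, ← dualMap_mul, ← dualMap_mul, ← dualMap_mul,
      mul_assoc f b, mul_assoc f, ← mul_assoc a' a e, key i p e _ he,
      show f * (b * b' * f) = f * ((b * b') * f) from rfl, key j q f _ hf]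
    have : ∀ (s t : k) (l r : WithConv (H →ₗ[k] k)), biact (s • l) (t • r) y =
        (s * t) • biact l r y := fun s t l r => eq_of_forall_functional (k := k) fun c => by
      rw [apply_biact, map_smul, apply_biact, smul_mul_assoc, smul_mul_assoc, mul_smul_comm,
        smul_smul]
      rfl
    rw [this]
    exact Submodule.smul_mem _ _ (Submodule.mem_span_singleton_self _)
  have hcoef : HasCoefficients π (blockCoalgebra φ i) (blockCoalgebra φ j) S := by
    refine hasCoefficients_iff.2 fun x hx a => ⟨⟨?_, ?_⟩, ?_, ?_⟩
    · have := hclosed a 1 x hx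
      rwa [dualMap_one] at this
    · have := hclosed 1 a x hx
      rwa [dualMap_one] at this
    · have h1 : S ≤ (blockCoalgebra φ i).comap ((π : H →ₗ[k] H) ∘ₗ biact 1 a) := by
        refine Submodule.span_le.2 ?_
        rintro _ ⟨a', b', rfl⟩
        rw [SetLike.mem_coe, Submodule.mem_comap, LinearMap.comp_apply]
        refine mem_blockCoalgebra.2 fun c hc' => ?_
        change (dualMap π c) (biact 1 a _) = 0
        rw [apply_biact, hz, apply_biact, apply_biact]
        have h0 : dualMap π e * dualMap π a' * dualMap π c = 0 := by
          rw [← dualMap_mul, ← dualMap_mul, hπ.dualMap_eq_zero_iff hc, mul_assoc]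
          refine (supportedAt_of_eq_single he).mem_rad_mul ?_
          rw [map_mul, Pi.mul_apply, hc', mul_zero]
        rw [one_mul]
        simp only [← mul_assoc]
        rw [h0]
        simp only [zero_mul]
        rfl
      exact h1 hx
    · have h1 : S ≤ (blockCoalgebra φ j).comap ((π : H →ₗ[k] H) ∘ₗ biact a 1) := by
        refine Submodule.span_le.2 ?_
        rintro _ ⟨a', b', rfl⟩
        rw [SetLike.mem_coe, Submodule.mem_comap, LinearMap.comp_apply]
        refine mem_blockCoalgebra.2 fun c hc' => ?_
        change (dualMap π c) (biact a 1 _) = 0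
        rw [apply_biact, hz, apply_biact, apply_biact]
        have h0 : dualMap π c * (dualMap π b' * dualMap π f) = 0 := by
          rw [← dualMap_mul, ← dualMap_mul, hπ.dualMap_eq_zero_iff hc, ← mul_assoc]
          refine (supportedAt_of_eq_single hf).mul_mem_rad ?_
          rw [map_mul, Pi.mul_apply, hc', zero_mul]
        rw [mul_one]
        simp only [mul_assoc]
        rw [h0]
        simp only [mul_zero]
        rfl
      exact h1 hx
  have hsub : IsSubBicomodule π S := by
    have h1 := hasCoefficients_iff.1 hcoef
    have h2 : ∀ x, π x ∈ coradical k H := fun x => hπ.range_eq ▸ ⟨x, rfl⟩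
    exact hasCoefficients_iff.2 fun x hx a => ⟨(h1 x hx a).1, h2 _, h2 _⟩
  refine ⟨S, ⟨hsub, fun h => hz0 ((Submodule.eq_bot_iff _).1 h z hzS), fun T hT hTS => ?_⟩, hcoef,
    hzS, le_rfl⟩
  by_contra! hcon
  obtain ⟨hT0, hTne⟩ := hcon
  obtain ⟨x, hx, hx0⟩ := (Submodule.ne_bot_iff _).1 hT0
  have hzT : z ∈ T := by
    obtain ⟨u, v, huv⟩ : ∃ u v : Fin (d i) → WithConv (H →ₗ[k] k),
        φ (∑ r, u r * e * v r) = Pi.single i 1 := by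
      obtain ⟨o, ho⟩ := hφ (Pi.single i 1)
      obtain ⟨u, v, h⟩ := (supportedAt_of_eq_single ho).exists_sum hφ he
      exact ⟨u, v, by rw [← ho, ← sub_eq_zero, ← map_sub, ← neg_sub, map_neg, mem_rad.1 h,
        neg_zero]⟩
    obtain ⟨u', v', huv'⟩ : ∃ u v : Fin (d j) → WithConv (H →ₗ[k] k),
        φ (∑ r, u r * f * v r) = Pi.single j 1 := by
      obtain ⟨o, ho⟩ := hφ (Pi.single j 1)
      obtain ⟨u, v, h⟩ := (supportedAt_of_eq_single ho).exists_sum hφ hf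
      exact ⟨u, v, by rw [← ho, ← sub_eq_zero, ← map_sub, ← neg_sub, map_neg, mem_rad.1 h,
        neg_zero]⟩
    -- The block identities, written through `e` and `f`, fix `S`. Hence some compression of a
    -- nonzero `x ∈ T` is nonzero; it is a multiple of `z`, so `T` contains the generator.
    have hfix : ∀ x ∈ S, biact (dualMap π (∑ r, u r * e * v r))
        (dualMap π (∑ r, u' r * f * v' r)) x = x := by
      intro x hx
      refine LinearMap.eqOn_span (f := biact _ _) (g := LinearMap.id) ?_ hx
      rintro _ ⟨a', b', rfl⟩
      rw [LinearMap.id_apply, hz, biact_biact, biact_biact, biact_biact, ← dualMap_mul,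
        ← dualMap_mul, ← dualMap_mul, ← dualMap_mul, ← dualMap_mul, ← dualMap_mul]
      congr 2
      · rw [hπ.dualMap_eq_iff hc, map_mul, map_mul, map_mul, huv, he]
        funext l
        by_cases hl : l = i
        · subst hl; simp
        · simp [hl]
      · rw [hπ.dualMap_eq_iff hc, map_mul, map_mul, map_mul, huv', hf]
        funext l
        by_cases hl : l = j
        · subst hl; simp
        · simp [hl]
    obtain ⟨r, s, hrs⟩ : ∃ r s, biact (dualMap π (u r * e)) (dualMap π (f * v' s)) x ≠ 0 := by
      by_contra! h
      refine hx0 ?_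
      rw [← hfix x (hTS hx)]
      refine eq_of_forall_functional (k := k) fun c => ?_
      rw [apply_biact, map_sum, map_sum, Finset.sum_mul, Finset.sum_mul_sum]
      rw [conv_sum_apply, map_zero]
      refine Finset.sum_eq_zero fun r _ => ?_
      rw [conv_sum_apply]
      refine Finset.sum_eq_zero fun s _ => ?_
      have := congrArg (fun y => (dualMap π (v r) * c * dualMap π (u' s)).ofConv y) (h r s)
      simp only [apply_biact, map_zero] at this
      rw [← this]
      simp only [dualMap_mul, mul_assoc]
    obtain ⟨t, ht⟩ := Submodule.mem_span_singleton.1 (hee x (hTS hx) (u r) (v' s))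
    have ht0 : t ≠ 0 := by
      rintro rfl
      exact hrs (by rw [← ht, zero_smul])
    rw [← Submodule.smul_mem_iff T ht0, ht]
    exact hT.biact_mem hx _ _
  refine hTne (le_antisymm hTS (Submodule.span_le.2 ?_))
  rintro _ ⟨a, b, rfl⟩
  exact hT.biact_mem hzT a b

/-- A link gives `x ∈ J ^ n` with a primitive corner outside `J ^ (n + 1)`. Duality gives `y ∈ P π
n` on which this corner does not vanish; its compression `z` generates a simple sub-bicomodule of
the required type, and `x z ≠ 0` keeps `z` out of `P π (n - 1)`. -/
theorem Link.isNondegenerateP (hπ : IsCoradicalProjection π)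
    (hc : coradical k H = perp (rad φ)) (hφ : Function.Surjective φ) (hd : ∀ i, 1 ≤ d i) {n : ℕ}
    (hn : 1 ≤ n) {i j : ι} (h : Link φ n i j) :
    IsNondegenerateP π n (blockCoalgebra φ i) (blockCoalgebra φ j) := by
  obtain ⟨e, he⟩ := hφ (Pi.single i (Matrix.single ⟨0, hd i⟩ ⟨0, hd i⟩ 1))
  obtain ⟨f, hf⟩ := hφ (Pi.single j (Matrix.single ⟨0, hd j⟩ ⟨0, hd j⟩ 1))
  obtain ⟨x, hx, hxn⟩ := h.exists_mul_mul_notMem hφ hn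
    ((hπ.map_dualMap hc e).trans he) ((hπ.map_dualMap hc f).trans hf)
  -- The range of `dualMap π` is a complement of `J`. Adding it to the subspace to be annihilated
  -- ensures `π y = 0`.
  have hI : dualMap π e * x * dualMap π f ∉ LinearMap.range (dualMap π) ⊔ rad φ ^ (n + 1) := by
    intro hmem
    obtain ⟨_, ⟨a, rfl⟩, b, hb, hab⟩ := Submodule.mem_sup.1 hmem
    have h1 : dualMap π a ∈ rad φ := by
      rw [← add_sub_cancel_right (dualMap π a) b, hab]
      exact sub_mem (rad_pow_le_rad hn (mul_mem_rad_pow_right hn _ (mul_mem_rad_pow_left hn _ hx)))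
        (rad_pow_le_rad (by omega) hb)
    rw [← hπ.dualMap_eq_zero_iff hc, hπ.dualMap_dualMap] at h1
    rw [h1, zero_add] at hab
    exact hxn (hab ▸ hb)
  obtain ⟨y, hy, hxy⟩ := exists_eval_ne_zero hI
  have hyP : y ∈ P π n := (hπ.mem_P_iff hc n y).2
    ⟨eq_of_forall_functional (k := k) fun c => by
      rw [map_zero]
      exact hy _ (Submodule.mem_sup_left ⟨c, rfl⟩),
    fun c hc' => hy c (Submodule.mem_sup_right hc')⟩
  set z := biact (dualMap π e) (dualMap π f) y with hz
  have hzx : x z ≠ 0 := by rwa [hz, apply_biact]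
  obtain ⟨S, hS, hSc, hzS, hSle⟩ := exists_simple_subBicomodule hπ hc hφ he hf
    (fun h => hzx (by rw [h, map_zero])) hz
  intro hle
  have hSP : S ≤ P π n := hSle.trans (Submodule.span_le.2 (by
    rintro _ ⟨a, b, rfl⟩
    exact hπ.biact_mem_P hc (hπ.biact_mem_P hc hyP e f) a b))
  have hSi : S ≤ isotypicP π n (blockCoalgebra φ i) (blockCoalgebra φ j) :=
    le_sSup ⟨hSP, hS, hSc⟩
  have h1 := hle (hSi hzS)
  rw [hπ.mem_P_iff hc, Nat.sub_add_cancel hn] at h1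
  exact hzx (h1.2 x hx)

end Isotypic

end HopfCoradical

namespace HopfCoradical

open Coalgebra WithConv

theorem sub_smul_mul_sub_smul {k A : Type*} [Field k] [Ring A] [Algebra k A] (r s : k)
    (e a b f : A) : (e * a - r • e) * (b * f - s • f) =
      e * (a * b) * f - s • (e * a * f) - (r • (e * b * f) - (r * s) • (e * f)) := by
  simp only [sub_mul, mul_sub, smul_mul_assoc, mul_smul_comm, mul_assoc, smul_sub, mul_smul]
  rw [smul_comm s r, sub_sub_sub_comm]

/-! ### Grouplikes, blocks of size one and skew-primitives -/

section GroupLike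

variable {k H : Type*} [Field k] [AddCommGroup H] [Module k H] [Coalgebra k H]
  [FiniteDimensional k H] {ι : Type*} {d : ι → ℕ}
  {φ : WithConv (H →ₗ[k] k) →ₐ[k] Π i, Matrix (Fin (d i)) (Fin (d i)) k}

/-- A one-dimensional block is spanned by a grouplike element. -/
theorem exists_isGroupLikeElem (i : ι) (hi : d i = 1) :
    ∃ g : H, IsGroupLikeElem k g ∧
      ∀ a : WithConv (H →ₗ[k] k), φ a i = algebraMap k _ (a g) := by
  have hs : Subsingleton (Fin (d i)) := by rw [hi]; infer_instance
  let z : Fin (d i) := ⟨0, by omega⟩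
  obtain ⟨g, hg⟩ := exists_eval (k := k) (H := H)
    (Matrix.entryLinearMap k k z z ∘ₗ LinearMap.proj i ∘ₗ φ.toLinearMap)
  have hg' : ∀ a : WithConv (H →ₗ[k] k), φ a i = algebraMap k _ (a g) := fun a => by
    ext p q
    rw [Subsingleton.elim p z, Subsingleton.elim q z, Matrix.algebraMap_matrix_apply, if_pos rfl,
      ← hg]
    rfl
  have hinj : Function.Injective (algebraMap k (Matrix (Fin (d i)) (Fin (d i)) k)) := by
    have : Nonempty (Fin (d i)) := ⟨z⟩
    exact (algebraMap k (Matrix (Fin (d i)) (Fin (d i)) k)).injective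
  refine ⟨g, isGroupLikeElem_of_mul_apply (hinj ?_) fun a b => hinj ?_, hg'⟩
  · rw [← hg', map_one, map_one, Pi.one_apply]
  · rw [← hg', map_mul, map_mul, Pi.mul_apply, hg', hg']

variable [DecidableEq ι]

theorem blockCoalgebra_eq_span (hφ : Function.Surjective φ) {i : ι} (hi : d i = 1) {g : H}
    (hg0 : g ≠ 0) (hg : g ∈ blockCoalgebra φ i) : blockCoalgebra φ i = Submodule.span k {g} := by
  refine (Submodule.eq_of_le_of_finrank_eq ((Submodule.span_singleton_le_iff_mem _ _).2 hg) ?_).symm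
  rw [finrank_blockCoalgebra hφ, finrank_span_singleton hg0, hi, one_pow]

/-- A grouplike element spans a one-dimensional block. -/
theorem exists_block_of_isGroupLikeElem [Fintype ι] (hφ : Function.Surjective φ) {N : ℕ}
    (hN : rad φ ^ N = ⊥) {g : H} (hg : IsGroupLikeElem k g) :
    ∃ i, d i = 1 ∧ blockCoalgebra φ i = Submodule.span k {g} := by
  let χ : WithConv (H →ₗ[k] k) →ₐ[k] k :=
    AlgHom.ofLinearMap (LinearMap.applyₗ g ∘ₗ (WithConv.linearEquiv k (H →ₗ[k] k)).toLinearMap)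
      hg.counit_eq_one (isGroupLikeElem_mul_apply hg)
  let ψ : WithConv (H →ₗ[k] k) →ₐ[k] Matrix (Fin 1) (Fin 1) k := (Algebra.ofId k _).comp χ
  have hψχ : ∀ a, ψ a = algebraMap k _ (a g) := fun a => rfl
  have hψ0 : ∀ a, ψ a = 0 → a g = 0 := fun a ha => by
    rw [hψχ] at ha
    exact (algebraMap k (Matrix (Fin 1) (Fin 1) k)).injective (by rw [ha, map_zero])
  have hψ : Function.Surjective ψ := by
    intro M
    refine ⟨algebraMap k _ (M 0 0), ?_⟩
    rw [AlgHom.commutes]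
    ext a b
    rw [Subsingleton.elim a 0, Subsingleton.elim b 0]
    simp [Matrix.algebraMap_matrix_apply]
  obtain ⟨e, he, hφe⟩ := exists_block_idempotents hφ hN
  obtain ⟨i, hi⟩ : ∃ i, ψ (e i) ≠ 0 := by
    by_contra! h
    have h1 : ψ 1 = 0 := by
      rw [← he.complete, map_sum]
      exact Finset.sum_eq_zero fun i _ => h i
    rw [map_one] at h1
    exact one_ne_zero h1
  have hs := supportedAt_of_eq_single (hφe i)
  have hi1 := size_eq_of_supportedAt hφ hN hψ hs hi
  exact ⟨i, hi1, blockCoalgebra_eq_span hφ hi1 hg.ne_zero fun a ha =>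
    hψ0 a (map_eq_zero_of_supportedAt hN hψ hs hi ha)⟩

/-- Without nontrivial skew-primitive elements there are no links between one-dimensional
blocks. -/
theorem not_link_of_noNontrivialSkewPrimitives (hφ : Function.Surjective φ)
    (hskew : NoNontrivialSkewPrimitives k H) {i j : ι} (hi : d i = 1) (hj : d j = 1) :
    ¬ Link φ 1 i j := by
  intro hlink
  obtain ⟨g, hg, hφg⟩ := exists_isGroupLikeElem (φ := φ) i hi
  obtain ⟨h, hh, hφh⟩ := exists_isGroupLikeElem (φ := φ) j hj
  obtain ⟨e, he⟩ := hφ (Pi.single i (Matrix.single ⟨0, by omega⟩ ⟨0, by omega⟩ 1))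
  obtain ⟨f, hf⟩ := hφ (Pi.single j (Matrix.single ⟨0, by omega⟩ ⟨0, by omega⟩ 1))
  obtain ⟨x, hx, hxn⟩ := hlink.exists_mul_mul_notMem hφ le_rfl he hf
  obtain ⟨y, hy, hxy⟩ := exists_eval_ne_zero hxn
  set z := biact e f y with hz
  have hea : ∀ a, e * a - a g • e ∈ rad φ := fun a => by
    rw [mem_rad, map_sub, map_mul, map_smul]
    funext l
    by_cases hl : l = i
    · subst hl
      rw [Pi.sub_apply, Pi.mul_apply, Pi.smul_apply, hφg a, Algebra.smul_def, ← Algebra.commutes,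
        sub_self, Pi.zero_apply]
    · simp [he, hl]
  have hbf : ∀ b, b * f - b h • f ∈ rad φ := fun b => by
    rw [mem_rad, map_sub, map_mul, map_smul]
    funext l
    by_cases hl : l = j
    · subst hl
      rw [Pi.sub_apply, Pi.mul_apply, Pi.smul_apply, hφh b, Algebra.smul_def, sub_self,
        Pi.zero_apply]
    · simp [hf, hl]
  -- `e a` and `b f` are scalar multiples of `e` and `f` modulo `J`, and `y` kills `J ^ 2`. Thus `z`
  -- is skew-primitive up to a multiple of `g ⊗ h`, which subtracting a multiple of `h` removes.
  have hmul : ∀ a b : WithConv (H →ₗ[k] k),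
      (a * b) z = a g * b z + b h * a z - a g * b h * (e * f) y := by
    intro a b
    have h1 := hy _ (show (e * a - a g • e) * (b * f - b h • f) ∈ rad φ ^ (1 + 1) by
      rw [pow_succ, pow_one]; exact Submodule.mul_mem_mul (hea a) (hbf b))
    rw [sub_smul_mul_sub_smul] at h1
    change (e * (a * b) * f) y - b h * (e * a * f) y -
      (a g * (e * b * f) y - a g * b h * (e * f) y) = 0 at h1
    rw [hz, apply_biact, apply_biact, apply_biact]
    linear_combination h1
  have hxz : x z ≠ 0 := by rwa [hz, apply_biact]
  set z' := z - (e * f) y • h with hz'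
  have hcomul : comul (R := k) z' = g ⊗ₜ[k] z' + z' ⊗ₜ[k] h := by
    refine tensor_ext fun a b => ?_
    rw [← mul_apply_contrL, map_add, map_add, contrL_tmul, contrL_tmul, map_smul, map_smul, hz']
    simp only [map_sub, map_smul, smul_eq_mul]
    rw [hmul, isGroupLikeElem_mul_apply hh]
    ring
  obtain ⟨r, hr⟩ := Submodule.mem_span_singleton.1 (hskew g h z' hg hh hcomul)
  -- `x` lies in `J` and so vanishes on grouplikes, hence on a trivial skew-primitive, whereas `x z
  -- ≠ 0`.
  have key : ∀ (l : ι) (u : H), d l = 1 → (∀ a : WithConv (H →ₗ[k] k),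
      φ a l = algebraMap k _ (a u)) → x u = 0 := fun l u hl hu => by
    have h1 := hu x
    rw [mem_rad.1 (by simpa using hx), Pi.zero_apply] at h1
    have : Nonempty (Fin (d l)) := ⟨⟨0, by omega⟩⟩
    exact (algebraMap k (Matrix (Fin (d l)) (Fin (d l)) k)).injective (by rw [← h1, map_zero])
  refine hxz ?_
  rw [← sub_add_cancel z ((e * f) y • h), ← hz', map_add, ← hr, map_smul, map_smul, map_sub,
    key i g hi hφg, key j h hj hφh, sub_zero, smul_zero, smul_zero, add_zero]

end GroupLike

end HopfCoradical

namespace HopfCoradical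

open Coalgebra WithConv HopfAlgebra

/-! ### The antipode and its transpose -/

section Antipode

variable {k H : Type*} [Field k] [Ring H] [HopfAlgebra k H]

theorem sum_left_tmul_antipode_mul (x : H) (R : Coalgebra.Repr k x (H × H)) :
    ∑ i ∈ R.index, ∑ j ∈ (ℛ k (R.left i)).index,
      (ℛ k (R.left i)).left j ⊗ₜ[k] (antipode k ((ℛ k (R.left i)).right j) * R.right i) =
      x ⊗ₜ[k] 1 := by
  have h := congrArg (LinearMap.lTensor H (LinearMap.mul' k H ∘ₗ LinearMap.rTensor H (antipode k)))
    (Coalgebra.sum_tmul_tmul_eq R (fun i => ℛ k (R.left i)) (fun i => ℛ k (R.right i)))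
  simp only [map_sum, LinearMap.lTensor_tmul, LinearMap.comp_apply, LinearMap.rTensor_tmul,
    LinearMap.mul'_apply] at h
  rw [h]
  simp only [← TensorProduct.tmul_sum, HopfAlgebra.sum_antipode_mul_eq_smul]
  simp only [← TensorProduct.smul_tmul, ← TensorProduct.sum_tmul]
  congr 1
  have := congrArg (TensorProduct.rid k H) (Coalgebra.sum_tmul_counit_eq R)
  simpa only [map_sum, TensorProduct.rid_tmul, one_smul] using this

theorem sum_antipode_mul_tmul (x : H) (R : Coalgebra.Repr k x (H × H)) :
    ∑ i ∈ R.index, (antipode k (R.left i) ⊗ₜ[k] (1 : H)) * comul (R.right i) =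
      1 ⊗ₜ[k] x := by
  have h := congrArg ((LinearMap.rTensor H (LinearMap.mul' k H ∘ₗ
    LinearMap.rTensor H (antipode k))) ∘ₗ (TensorProduct.assoc k H H H).symm.toLinearMap)
    (Coalgebra.sum_tmul_tmul_eq R (fun i => ℛ k (R.left i)) (fun i => ℛ k (R.right i)))
  simp only [map_sum, LinearMap.comp_apply, LinearEquiv.coe_coe, TensorProduct.assoc_symm_tmul,
    LinearMap.rTensor_tmul, LinearMap.mul'_apply] at h
  simp only [← (ℛ k (R.right _)).eq, Finset.mul_sum, Algebra.TensorProduct.tmul_mul_tmul, one_mul]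
  rw [← h]
  simp only [← TensorProduct.sum_tmul, HopfAlgebra.sum_antipode_mul_eq_smul]
  simp only [TensorProduct.smul_tmul, ← TensorProduct.tmul_sum]
  congr 1
  exact Coalgebra.sum_counit_smul R

/-- The antipode reverses the comultiplication. -/
theorem comul_antipode (x : H) : comul (R := k) (antipode k x) =
    TensorProduct.map (antipode k) (antipode k) (TensorProduct.comm k H H (comul x)) := by
  let G : H →ₗ[k] H ⊗[k] H := TensorProduct.map (antipode k) (antipode k) ∘ₗ
    (TensorProduct.comm k H H).toLinearMap ∘ₗ comul
  -- `G` is a left convolution inverse of the comultiplication, and the comultiplication composed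
  -- with the antipode is a right one, so the two agree.
  have hG : toConv G * toConv (comul (R := k) (A := H)) = 1 := by
    refine WithConv.ext (LinearMap.ext fun x => ?_)
    have h1 := (ℛ k x).convMul_apply (toConv G) (toConv (comul (R := k) (A := H)))
    refine h1.trans ?_
    have h := congrArg ((LinearMap.mul' k (H ⊗[k] H)) ∘ₗ TensorProduct.map
        (TensorProduct.map (antipode k) (antipode k) ∘ₗ (TensorProduct.comm k H H).toLinearMap)
        (comul (R := k) (A := H)) ∘ₗ (TensorProduct.assoc k H H H).symm.toLinearMap)
      (Coalgebra.sum_tmul_tmul_eq (ℛ k x) (fun i => ℛ k ((ℛ k x).left i))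
        (fun i => ℛ k ((ℛ k x).right i)))
    simp only [map_sum, LinearMap.comp_apply, LinearEquiv.coe_coe, TensorProduct.assoc_symm_tmul,
      TensorProduct.map_tmul, TensorProduct.comm_tmul, LinearMap.mul'_apply] at h
    have h2 : ∀ i, G ((ℛ k x).left i) = ∑ j ∈ (ℛ k ((ℛ k x).left i)).index,
        antipode k ((ℛ k ((ℛ k x).left i)).right j) ⊗ₜ
          antipode k ((ℛ k ((ℛ k x).left i)).left j) := fun i => by
      change TensorProduct.map _ _ (TensorProduct.comm k H H (comul _)) = _
      rw [← (ℛ k ((ℛ k x).left i)).eq]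
      simp
    have h3 : ∀ i, ∑ j ∈ (ℛ k ((ℛ k x).right i)).index,
        (antipode k ((ℛ k ((ℛ k x).right i)).left j) ⊗ₜ[k] antipode k ((ℛ k x).left i)) *
          comul ((ℛ k ((ℛ k x).right i)).right j) =
        1 ⊗ₜ (antipode k ((ℛ k x).left i) * (ℛ k x).right i) := fun i => by
      have h4 := congrArg (fun w => ((1 : H) ⊗ₜ[k] antipode k ((ℛ k x).left i)) * w)
        (sum_antipode_mul_tmul ((ℛ k x).right i) (ℛ k ((ℛ k x).right i)))
      simpa only [Finset.mul_sum, ← mul_assoc, Algebra.TensorProduct.tmul_mul_tmul, one_mul,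
        mul_one] using h4
    calc _ = ∑ i ∈ (ℛ k x).index, G ((ℛ k x).left i) * comul ((ℛ k x).right i) := rfl
      _ = _ := by
        simp only [h2, Finset.sum_mul]
        rw [h]
        simp only [h3, ← TensorProduct.tmul_sum, HopfAlgebra.sum_antipode_mul_eq_smul]
        rw [LinearMap.convOne_apply, Algebra.algebraMap_eq_smul_one, TensorProduct.tmul_smul]
        rfl
  have := left_inv_eq_right_inv hG LinearMap.comul_right_inv
  exact (LinearMap.congr_fun (congrArg WithConv.ofConv this) x).symm

/-- The transpose of the antipode. -/
noncomputable def ant : WithConv (H →ₗ[k] k) →ₗ[k] WithConv (H →ₗ[k] k) where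
  toFun a := toConv (a.ofConv ∘ₗ antipode k)
  map_add' _ _ := rfl
  map_smul' _ _ := rfl

theorem ant_apply (a : WithConv (H →ₗ[k] k)) (x : H) : ant a x = a (antipode k x) := rfl

theorem ant_mul (a b : WithConv (H →ₗ[k] k)) : ant (a * b) = ant b * ant a := by
  refine WithConv.ext (LinearMap.ext fun x => ?_)
  change (a * b) (antipode k x) = (ant b * ant a) x
  rw [mul_apply_contrL, mul_apply_contrL, comul_antipode]
  generalize (comul x : H ⊗[k] H) = w
  induction w with
  | zero => simp
  | tmul x y => simp [ant_apply, mul_comm]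
  | add x y hx hy => simp only [map_add, hx, hy]

end Antipode

end HopfCoradical

namespace HopfCoradical

open Coalgebra WithConv HopfAlgebra

section Dual

variable {k H : Type*} [Field k] [AddCommGroup H] [Module k H]

/-- The elements of a dual basis. -/
noncomputable def dualBasisElem {ι : Type*} (b : Module.Basis ι k H) (i : ι) :
    WithConv (H →ₗ[k] k) :=
  toConv (b.coord i)

theorem sum_dualBasisElem_smul {ι : Type*} [Fintype ι] (b : Module.Basis ι k H) (y : H) :
    ∑ i, dualBasisElem b i y • b i = y := b.sum_repr y

theorem sum_apply_smul_dualBasisElem {ι : Type*} [Fintype ι] (b : Module.Basis ι k H)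
    (c : WithConv (H →ₗ[k] k)) : ∑ i, c (b i) • dualBasisElem b i = c := by
  refine WithConv.ext (LinearMap.ext fun y => ?_)
  rw [conv_sum_apply]
  conv_rhs => rw [← sum_dualBasisElem_smul b y, map_sum]
  exact Finset.sum_congr rfl fun i _ => (mul_comm _ _).trans (map_smul c.ofConv _ _).symm

theorem sum_bilin_eq_sum_dualBasisElem {V : Type*} [AddCommGroup V] [Module k V] {ι κ : Type*}
    [Fintype ι] (b : Module.Basis ι k H) (B : H →ₗ[k] WithConv (H →ₗ[k] k) →ₗ[k] V)
    (s : Finset κ) (u : κ → H) (c : κ → WithConv (H →ₗ[k] k)) :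
    ∑ i ∈ s, B (u i) (c i) = ∑ j, B (∑ i ∈ s, c i (b j) • u i) (dualBasisElem b j) := by
  simp only [map_sum, LinearMap.sum_apply, map_smul, LinearMap.smul_apply]
  rw [Finset.sum_comm]
  refine Finset.sum_congr rfl fun i _ => ?_
  conv_lhs => rw [← sum_apply_smul_dualBasisElem b (c i), map_sum]
  simp only [map_smul]

/-- `H ⊗ H*` is identified with the endomorphisms of `H`, so an identity between such tensors may be
checked by evaluating operators at `y`. The integral computations below rest on this. -/
theorem sum_bilin_eq_of_forall_sum_smul_eq [FiniteDimensional k H] {V : Type*} [AddCommGroup V]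
    [Module k V] (B : H →ₗ[k] WithConv (H →ₗ[k] k) →ₗ[k] V) {κ κ' : Type*} (s : Finset κ)
    (s' : Finset κ') (u : κ → H) (c : κ → WithConv (H →ₗ[k] k)) (u' : κ' → H)
    (c' : κ' → WithConv (H →ₗ[k] k))
    (h : ∀ y, ∑ i ∈ s, c i y • u i = ∑ i ∈ s', c' i y • u' i) :
    ∑ i ∈ s, B (u i) (c i) = ∑ i ∈ s', B (u' i) (c' i) := by
  rw [sum_bilin_eq_sum_dualBasisElem (Module.finBasis k H),
    sum_bilin_eq_sum_dualBasisElem (Module.finBasis k H) B s']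
  simp only [h]

theorem contrR_add (a b : WithConv (H →ₗ[k] k)) (w : H ⊗[k] H) :
    contrR (a + b) w = contrR a w + contrR b w := by
  induction w with
  | zero => simp
  | tmul x y => simp [add_smul]
  | add x y hx hy => simp only [map_add, hx, hy]; abel

theorem contrR_smul (r : k) (a : WithConv (H →ₗ[k] k)) (w : H ⊗[k] H) :
    contrR (r • a) w = r • contrR a w := by
  induction w with
  | zero => simp
  | tmul x y => simp [mul_smul]
  | add x y hx hy => simp only [map_add, smul_add, hx, hy]

end Dual

/-! ### Integrals and the Frobenius form (Larson–Sweedler) -/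

section Integral

variable {k H : Type*} [Field k] [Ring H] [HopfAlgebra k H]

/-- The right action `h ◁ a = a(S(h₂)) h₁` of the dual algebra. -/
noncomputable def antAct : H →ₗ[k] WithConv (H →ₗ[k] k) →ₗ[k] H :=
  LinearMap.mk₂ k (fun h a => contrR (ant a) (comul h))
    (fun _ _ _ => by rw [map_add, map_add]) (fun _ _ _ => by rw [map_smul, map_smul])
    (fun _ _ _ => by rw [map_add, contrR_add]) (fun _ _ _ => by rw [map_smul, contrR_smul])

theorem antAct_apply (h : H) (a : WithConv (H →ₗ[k] k)) :
    antAct h a = contrR (ant a) (comul h) := rfl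

theorem antAct_antAct (h : H) (a c : WithConv (H →ₗ[k] k)) :
    antAct (antAct h a) c = antAct h (a * c) := by
  rw [antAct_apply, antAct_apply, contrR_comul_contrR, ← ant_mul, antAct_apply]

theorem antAct_one (h : H) : antAct h (1 : WithConv (H →ₗ[k] k)) = h := by
  have : ant (1 : WithConv (H →ₗ[k] k)) = 1 :=
    WithConv.ext (LinearMap.ext fun x => HopfAlgebra.counit_antipode x)
  rw [antAct_apply, this, contrR_one_comul]

/-- The functional `y ↦ a(y x)`. -/
noncomputable def translate (x : H) (a : WithConv (H →ₗ[k] k)) : WithConv (H →ₗ[k] k) :=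
  toConv (a.ofConv ∘ₗ LinearMap.mulRight k x)

theorem translate_apply (x y : H) (a : WithConv (H →ₗ[k] k)) : translate x a y = a (y * x) := rfl

/-- The Hopf module compatibility of left multiplication with the action `◁`, obtained by inserting
`x₁ ⊗ S(x₂) x₃ = x ⊗ 1`. -/
theorem mul_antAct (x h : H) (R : Coalgebra.Repr k x (H × H)) (a : WithConv (H →ₗ[k] k)) :
    x * antAct h a = ∑ i ∈ R.index, antAct (R.left i * h) (translate (R.right i) a) := by
  simp only [antAct_apply, Bialgebra.comul_mul]
  generalize (comul h : H ⊗[k] H) = w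
  induction w with
  | zero => simp
  | add w w' hw hw' => simp only [map_add, mul_add, hw, hw', Finset.sum_add_distrib]
  | tmul p q =>
    have h := congrArg (contrR (toConv (a.ofConv ∘ₗ LinearMap.mulLeft k (antipode k q))))
      (sum_left_tmul_antipode_mul x R)
    replace h := congrArg (fun y => y * p) h
    simp only [map_sum, contrR_tmul, Finset.sum_mul, smul_mul_assoc] at h
    simp only [contrR_tmul, ant_apply]
    rw [mul_smul_comm]
    refine Eq.trans ?_ (h.symm.trans ?_)
    · simp
    · refine Finset.sum_congr rfl fun i _ => ?_
      rw [← (ℛ k (R.left i)).eq]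
      simp only [Finset.sum_mul, Algebra.TensorProduct.tmul_mul_tmul, map_sum, contrR_tmul]
      refine Finset.sum_congr rfl fun j _ => ?_
      rw [ant_apply, translate_apply, HopfAlgebra.antipode_mul_antidistrib, mul_assoc]
      rfl

/-- `t` is a left integral. -/
def IsLeftIntegral (k : Type*) {H : Type*} [Field k] [Ring H] [HopfAlgebra k H] (t : H) : Prop :=
  ∀ x : H, x * t = counit (R := k) x • t

theorem IsLeftIntegral.mul_antAct {t : H} (ht : IsLeftIntegral k t) (x : H)
    (a : WithConv (H →ₗ[k] k)) : x * antAct t a = antAct t (translate x a) := by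
  rw [HopfCoradical.mul_antAct x t (ℛ k x)]
  have h1 : ∀ i, antAct ((ℛ k x).left i * t) (translate ((ℛ k x).right i) a) =
      antAct t (translate (counit (R := k) ((ℛ k x).left i) • (ℛ k x).right i) a) := fun i => by
    have h2 : ∀ (r : k) (y : H), translate (r • y) a = r • translate y a := fun r y =>
      WithConv.ext (LinearMap.ext fun z => by
        change a (z * r • y) = r • a (z * y)
        rw [mul_smul_comm, map_smul])
    rw [ht, map_smul, LinearMap.smul_apply, h2, map_smul]
  rw [Finset.sum_congr rfl fun i _ => h1 i, ← map_sum]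
  congr 1
  conv_rhs => rw [← Coalgebra.sum_counit_smul (ℛ k x)]
  refine WithConv.ext (LinearMap.ext fun z => ?_)
  rw [conv_sum_apply]
  simp only [translate_apply, Finset.mul_sum, map_sum]

variable [FiniteDimensional k H]

/-- The projection onto the space of left integrals. -/
noncomputable def toIntegral (k : Type*) {H : Type*} [Field k] [Ring H] [HopfAlgebra k H]
    [FiniteDimensional k H] (h : H) : H :=
  ∑ i, antAct (Module.finBasis k H i * h) (ant (dualBasisElem (Module.finBasis k H) i))

/-- The tensor defining `toIntegral` represents the operator `S`, and multiplying by `x` turns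
`S(y)` into `x₁ S(y x₂) = x₁ S(x₂) S(y) = ε(x) S(y)`. -/
theorem isLeftIntegral_toIntegral (h : H) : IsLeftIntegral k (toIntegral k h) := by
  intro x
  let b := Module.finBasis k H
  let R := ℛ k x
  have hc := sum_bilin_eq_of_forall_sum_smul_eq (antAct ∘ₗ LinearMap.mulRight k h)
    (R.index ×ˢ Finset.univ) Finset.univ (fun p => R.left p.1 * b p.2)
    (fun p => translate (R.right p.1) (ant (dualBasisElem b p.2)))
    (fun i => counit (R := k) x • b i) (fun i => ant (dualBasisElem b i)) fun y => by
      have h1 : ∀ i, ∑ j, translate (R.right i) (ant (dualBasisElem b j)) y • (R.left i * b j) =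
          R.left i * antipode k (R.right i) * antipode k y := fun i => by
        conv_rhs => rw [mul_assoc, ← HopfAlgebra.antipode_mul_antidistrib,
          ← sum_dualBasisElem_smul b (antipode k (y * R.right i)), Finset.mul_sum]
        exact Finset.sum_congr rfl fun j _ => (mul_smul_comm _ _ _).symm
      rw [Finset.sum_product]
      simp only [h1]
      rw [← Finset.sum_mul, HopfAlgebra.sum_mul_antipode_eq_smul, smul_mul_assoc, one_mul]
      conv_lhs => rw [← sum_dualBasisElem_smul b (antipode k y), Finset.smul_sum]
      exact Finset.sum_congr rfl fun j _ => smul_comm _ _ _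
  rw [Finset.sum_product_right] at hc
  rw [toIntegral, Finset.mul_sum, Finset.smul_sum]
  refine (Finset.sum_congr rfl fun i _ => ?_).trans (hc.trans (Finset.sum_congr rfl fun i _ => ?_))
  · rw [mul_antAct x _ R]
    exact Finset.sum_congr rfl fun p _ => by rw [← mul_assoc]; rfl
  · rw [map_smul]
    rfl

/-- The reconstruction half of the fundamental theorem of Hopf modules, from `S(y₁) y₂ = ε(y)`. It
shows that nonzero integrals exist, as otherwise `1 = 0`. -/
theorem sum_antAct_toIntegral (h : H) :
    ∑ j, antAct (toIntegral k (Module.finBasis k H j * h))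
      (dualBasisElem (Module.finBasis k H) j) = h := by
  let b := Module.finBasis k H
  have hc := sum_bilin_eq_of_forall_sum_smul_eq (antAct ∘ₗ LinearMap.mulRight k h)
    Finset.univ {()} (fun p : Fin (Module.finrank k H) × Fin (Module.finrank k H) => b p.2 * b p.1)
    (fun p => ant (dualBasisElem b p.2) * dualBasisElem b p.1)
    (fun _ => (1 : H)) (fun _ => (1 : WithConv (H →ₗ[k] k))) fun y => by
      rw [Fintype.sum_prod_type, Finset.sum_singleton, one_apply_counit,
        ← HopfAlgebra.sum_antipode_mul_eq_smul (ℛ k y)]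
      have h2 : ∀ i j, (ant (dualBasisElem b i) * dualBasisElem b j) y =
          ∑ s ∈ (ℛ k y).index, dualBasisElem b i (antipode k ((ℛ k y).left s)) *
            dualBasisElem b j ((ℛ k y).right s) := fun i j => by
        rw [mul_apply_contrL, ← (ℛ k y).eq, map_sum, map_sum]
        refine Finset.sum_congr rfl fun s _ => ?_
        rw [contrL_tmul, map_smul, ant_apply, smul_eq_mul]
      simp only [h2, Finset.sum_smul]
      rw [Finset.sum_comm, Finset.sum_congr rfl fun i _ => Finset.sum_comm, Finset.sum_comm]
      refine Finset.sum_congr rfl fun s _ => ?_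
      conv_rhs => rw [← sum_dualBasisElem_smul b (antipode k ((ℛ k y).left s)),
        ← sum_dualBasisElem_smul b ((ℛ k y).right s), Finset.sum_mul_sum]
      simp only [smul_mul_smul_comm]
  rw [Fintype.sum_prod_type, Finset.sum_singleton] at hc
  refine (Finset.sum_congr rfl fun j _ => ?_).trans (hc.trans ?_)
  · rw [toIntegral, map_sum, LinearMap.sum_apply]
    refine Finset.sum_congr rfl fun i _ => ?_
    rw [antAct_antAct, ← mul_assoc]
    rfl
  · rw [LinearMap.comp_apply, LinearMap.mulRight_apply, one_mul, antAct_one]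

theorem exists_isLeftIntegral (k H : Type*) [Field k] [Ring H] [HopfAlgebra k H]
    [FiniteDimensional k H] : ∃ t : H, t ≠ 0 ∧ IsLeftIntegral k t := by
  by_contra! h
  have h0 : ∀ h' : H, toIntegral k h' = 0 := fun h' => by
    by_contra hne
    exact h _ hne (isLeftIntegral_toIntegral h')
  have h1 : (1 : H) = 0 := by
    rw [← sum_antAct_toIntegral (k := k) (1 : H)]
    exact Finset.sum_eq_zero fun j _ => by rw [h0, map_zero, LinearMap.zero_apply]
  have h2 := congrArg (counit (R := k)) h1
  rw [Bialgebra.counit_one, map_zero] at h2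
  exact one_ne_zero h2

/-- Reduces to `y₁ S(y₂) = ε(y)`. Applied to the translates of `a` it recovers every value `a x`
from `t ◁ a`, whence injectivity below. -/
theorem IsLeftIntegral.toIntegral_antAct {t : H} (ht : IsLeftIntegral k t)
    (a : WithConv (H →ₗ[k] k)) : toIntegral k (antAct t a) = a 1 • t := by
  let b := Module.finBasis k H
  rw [toIntegral]
  simp only [ht.mul_antAct, antAct_antAct]
  rw [← map_sum]
  have : ∑ i, translate (b i) a * ant (dualBasisElem b i) = a 1 • 1 := by
    refine WithConv.ext (LinearMap.ext fun y => ?_)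
    change (∑ i, translate (b i) a * ant (dualBasisElem b i)) y = a 1 • counit (R := k) y
    rw [conv_sum_apply]
    have h2 : ∀ i, (translate (b i) a * ant (dualBasisElem b i)) y =
        ∑ s ∈ (ℛ k y).index,
          a ((ℛ k y).left s * dualBasisElem b i (antipode k ((ℛ k y).right s)) • b i) := fun i => by
      rw [mul_apply_contrL, ← (ℛ k y).eq]
      simp [ant_apply, translate_apply, mul_comm]
    simp only [h2]
    rw [Finset.sum_comm]
    simp only [← map_sum, ← Finset.mul_sum, sum_dualBasisElem_smul]
    rw [HopfAlgebra.sum_mul_antipode_eq_smul, map_smul, smul_eq_mul, smul_eq_mul, mul_comm]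
  change antAct t (∑ i, translate (b i) a * ant (dualBasisElem b i)) = _
  rw [this, map_smul, antAct_one]

theorem IsLeftIntegral.antAct_injective {t : H} (ht : IsLeftIntegral k t) (ht0 : t ≠ 0) :
    Function.Injective (antAct (k := k) t) := by
  rw [← LinearMap.ker_eq_bot, LinearMap.ker_eq_bot']
  intro a ha
  refine WithConv.ext (LinearMap.ext fun x => ?_)
  have h1 := ht.toIntegral_antAct (translate x a)
  rw [← ht.mul_antAct, ha, mul_zero, translate_apply, one_mul] at h1
  have h2 : toIntegral k (0 : H) = 0 := Finset.sum_eq_zero fun i _ => by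
    rw [mul_zero, map_zero, LinearMap.zero_apply]
  rw [h2] at h1
  exact (smul_eq_zero.1 h1.symm).resolve_right ht0

theorem finrank_withConv_dual (k H : Type*) [Field k] [AddCommGroup H] [Module k H] :
    Module.finrank k (WithConv (H →ₗ[k] k)) = Module.finrank k H :=
  (LinearEquiv.finrank_eq (WithConv.linearEquiv k (H →ₗ[k] k))).trans Subspace.dual_finrank_eq

/-- The dual of a finite-dimensional Hopf algebra is a Frobenius algebra. -/
theorem exists_frobenius_form (k H : Type*) [Field k] [Ring H] [HopfAlgebra k H]
    [FiniteDimensional k H] :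
    ∃ T : WithConv (H →ₗ[k] k) →ₗ[k] k, ∀ a, (∀ b, T (a * b) = 0) → a = 0 := by
  obtain ⟨t, ht0, ht⟩ := exists_isLeftIntegral k H
  have hs : Function.Surjective (antAct (k := k) t) :=
    (LinearMap.injective_iff_surjective_of_finrank_eq_finrank (finrank_withConv_dual k H)).1
      (ht.antAct_injective ht0)
  -- The form is evaluation at `t`: its value on `a * ant c` is `a (t ◁ c)`, and the elements `t ◁
  -- c` exhaust `H`.
  refine ⟨LinearMap.applyₗ t ∘ₗ (WithConv.linearEquiv k (H →ₗ[k] k)).toLinearMap, fun a ha => ?_⟩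
  refine WithConv.ext (LinearMap.ext fun y => ?_)
  obtain ⟨c, rfl⟩ := hs y
  rw [antAct_apply, ← mul_apply_contrR]
  exact ha _

/-- `t ◁ a` depends on `a` only through `ant a`, so injectivity of the action on `t` passes to
`ant`. -/
theorem ant_surjective (k H : Type*) [Field k] [Ring H] [HopfAlgebra k H]
    [FiniteDimensional k H] : Function.Surjective (ant (k := k) (H := H)) := by
  obtain ⟨t, ht0, ht⟩ := exists_isLeftIntegral k H
  refine LinearMap.injective_iff_surjective.1 fun a b hab => ht.antAct_injective ht0 ?_
  rw [antAct_apply, antAct_apply, hab]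

end Integral

end HopfCoradical

namespace HopfCoradical

open Coalgebra WithConv HopfAlgebra

theorem exists_linearProjection {k V : Type*} [Field k] [AddCommGroup V] [Module k V]
    (J : Submodule k V) : ∃ q : V →ₗ[k] V, (∀ z, q z ∈ J) ∧ ∀ z ∈ J, q z = z := by
  obtain ⟨q, hq⟩ := LinearMap.exists_leftInverse_of_injective J.subtype J.ker_subtype
  exact ⟨J.subtype ∘ₗ q, fun z => (q z).2, fun z hz =>
    congrArg Subtype.val (LinearMap.congr_fun hq (⟨z, hz⟩ : J))⟩

/-! ### Maschke's theorem for the dual algebra -/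

section Maschke

variable {k H : Type*} [Field k] [Ring H] [HopfAlgebra k H]

/-- The functional `y ↦ λ(u S(y))`. -/
noncomputable def antipodePairing (l : WithConv (H →ₗ[k] k)) : H →ₗ[k] WithConv (H →ₗ[k] k) where
  toFun u := toConv (l.ofConv ∘ₗ LinearMap.mulLeft k u ∘ₗ antipode k)
  map_add' u v := WithConv.ext (LinearMap.ext fun y => by
    change l ((u + v) * antipode k y) = l (u * antipode k y) + l (v * antipode k y)
    rw [add_mul, map_add])
  map_smul' r u := WithConv.ext (LinearMap.ext fun y => by
    change l (r • u * antipode k y) = r • l (u * antipode k y)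
    rw [smul_mul_assoc, map_smul])

theorem antipodePairing_apply (l : WithConv (H →ₗ[k] k)) (u y : H) :
    antipodePairing l u y = l (u * antipode k y) := rfl

/-- For a left integral `λ` of the dual algebra, `λ(x₂ S(y)) x₁ = λ(x S(y₁)) y₂`. -/
theorem antipodePairing_contrL {l : WithConv (H →ₗ[k] k)}
    (hl : ∀ c : WithConv (H →ₗ[k] k), c * l = c 1 • l) (a : WithConv (H →ₗ[k] k)) (u : H) :
    antipodePairing l (contrL a (comul u)) = antipodePairing l u * a := by
  refine WithConv.ext (LinearMap.ext fun y => ?_)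
  have hl' : ∀ (c : WithConv (H →ₗ[k] k)) (x : H), l (contrL c (comul x)) = c 1 * l x :=
      fun c x => by
    rw [← mul_apply_contrL, hl]
    rfl
  let R := ℛ k y
  have h1 : (antipodePairing l u * a) y =
      ∑ i ∈ R.index, l (contrL (translate (R.right i) a) (comul (u * antipode k (R.left i)))) := by
    rw [mul_apply_contrR, ← R.eq, map_sum, map_sum]
    refine Finset.sum_congr rfl fun i _ => ?_
    rw [contrR_tmul, map_smul, hl', translate_apply, one_mul, antipodePairing_apply, smul_eq_mul]
  refine Eq.trans ?_ h1.symm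
  rw [antipodePairing_apply]
  simp only [Bialgebra.comul_mul]
  generalize (comul u : H ⊗[k] H) = w
  induction w with
  | zero => simp
  | add w w' hw hw' => simp only [map_add, add_mul, hw, hw', Finset.sum_add_distrib]
  | tmul p q =>
    have h := congrArg (contrR (toConv (a.ofConv ∘ₗ LinearMap.mulLeft k p)))
      (sum_left_tmul_antipode_mul y R)
    replace h := congrArg (fun v => l (q * antipode k v)) h
    simp only [map_sum, contrR_tmul, Finset.mul_sum, map_smul, mul_smul_comm] at h
    rw [contrL_tmul, smul_mul_assoc, map_smul]
    refine Eq.trans ?_ (h.symm.trans ?_)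
    · simp
    · refine Finset.sum_congr rfl fun i _ => ?_
      rw [comul_antipode, ← (ℛ k (R.left i)).eq]
      simp only [Finset.mul_sum, Algebra.TensorProduct.tmul_mul_tmul, map_sum, contrL_tmul,
        TensorProduct.comm_tmul, TensorProduct.map_tmul]
      refine Finset.sum_congr rfl fun j _ => ?_
      rw [translate_apply, mul_assoc, map_smul]
      rfl

/-- The functional `x ↦ a(h x)`. -/
noncomputable def translateLeft (h : H) (a : WithConv (H →ₗ[k] k)) : WithConv (H →ₗ[k] k) :=
  toConv (a.ofConv ∘ₗ LinearMap.mulLeft k h)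

theorem translateLeft_apply (h x : H) (a : WithConv (H →ₗ[k] k)) :
    translateLeft h a x = a (h * x) := rfl

theorem translateLeft_mul {g : H} (hg : IsGroupLikeElem k g) (a b : WithConv (H →ₗ[k] k)) :
    translateLeft g (a * b) = translateLeft g a * translateLeft g b := by
  refine WithConv.ext (LinearMap.ext fun x => ?_)
  change (a * b) (g * x) = (translateLeft g a * translateLeft g b) x
  rw [mul_apply_contrL, mul_apply_contrL, Bialgebra.comul_mul, hg.comul_eq_tmul_self]
  generalize (comul x : H ⊗[k] H) = w
  induction w with
  | zero => simp
  | tmul x y => simp [translateLeft_apply]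
  | add x y hx hy => simp only [map_add, mul_add, hx, hy]

theorem translateLeft_translateLeft_antipode {g : H} (hg : IsGroupLikeElem k g)
    (a : WithConv (H →ₗ[k] k)) : translateLeft g (translateLeft (antipode k g) a) = a := by
  refine WithConv.ext (LinearMap.ext fun x => ?_)
  change a (antipode k g * (g * x)) = a x
  rw [← mul_assoc, hg.antipode_mul_cancel, one_mul]

variable [FiniteDimensional k H]

/-- Together with `antipodePairing_contrL`, this makes the sum of `bᵢ* ⊗ l(bᵢ S(-))` a separability
idempotent when `l` is a normalised left integral. -/
theorem sum_dualBasisElem_mul_antipodePairing {l : WithConv (H →ₗ[k] k)} (hl1 : l 1 = 1) :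
    ∑ i, dualBasisElem (Module.finBasis k H) i * antipodePairing l (Module.finBasis k H i) = 1 := by
  let b := Module.finBasis k H
  refine WithConv.ext (LinearMap.ext fun y => ?_)
  change (∑ i, dualBasisElem b i * antipodePairing l (b i)) y = counit (R := k) y
  have h2 : ∀ i, (dualBasisElem b i * antipodePairing l (b i)) y =
      ∑ s ∈ (ℛ k y).index,
        l ((dualBasisElem b i ((ℛ k y).left s) • b i) * antipode k ((ℛ k y).right s)) := fun i => by
    rw [mul_apply_contrL, ← (ℛ k y).eq, map_sum, map_sum]
    refine Finset.sum_congr rfl fun s _ => ?_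
    rw [contrL_tmul, map_smul, antipodePairing_apply, smul_mul_assoc, map_smul]
  rw [conv_sum_apply]
  simp only [h2]
  rw [Finset.sum_comm]
  simp only [← map_sum, ← Finset.sum_mul, sum_dualBasisElem_smul]
  rw [HopfAlgebra.sum_mul_antipode_eq_smul, map_smul, hl1, smul_eq_mul, mul_one]

/-- Maschke's theorem: a normalized left integral of the dual algebra kills every nilpotent
ideal. -/
theorem eq_bot_of_isLeftIntegral_dual {l : WithConv (H →ₗ[k] k)}
    (hl : ∀ c : WithConv (H →ₗ[k] k), c * l = c 1 • l) (hl1 : l 1 = 1)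
    {J : Submodule k (WithConv (H →ₗ[k] k))} (hJl : ∀ a, ∀ x ∈ J, a * x ∈ J)
    (hJn : ∀ x ∈ J, IsNilpotent x) : J = ⊥ := by
  obtain ⟨q', hq'J, hq'⟩ := exists_linearProjection J
  let b := Module.finBasis k H
  -- Averaging the linear projection onto `J` makes it left linear. It is then right multiplication
  -- by `Q 1`, a nilpotent element of `J`, while still being the identity on `J`.
  let Q : WithConv (H →ₗ[k] k) → WithConv (H →ₗ[k] k) := fun z =>
    ∑ i, dualBasisElem b i * q' (antipodePairing l (b i) * z)
  have hQ : ∀ z ∈ J, Q z = z := fun z hz => by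
    have h1 : ∀ i, dualBasisElem b i * q' (antipodePairing l (b i) * z) =
        dualBasisElem b i * antipodePairing l (b i) * z := fun i => by
      rw [hq' _ (hJl _ _ hz), mul_assoc]
    simp only [Q, h1]
    rw [← Finset.sum_mul, sum_dualBasisElem_mul_antipodePairing hl1, one_mul]
  have hQmul : ∀ a, Q a = a * Q 1 := fun a => by
    let B : H →ₗ[k] WithConv (H →ₗ[k] k) →ₗ[k] WithConv (H →ₗ[k] k) :=
      (LinearMap.mul k (WithConv (H →ₗ[k] k))).flip ∘ₗ q' ∘ₗ antipodePairing l
    have hc := sum_bilin_eq_of_forall_sum_smul_eq B Finset.univ Finset.univ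
      (fun i => contrL a (comul (b i))) (fun i => dualBasisElem b i)
      (fun i => b i) (fun i => a * dualBasisElem b i) fun y => by
        have h1 : ∀ i, (a * dualBasisElem b i) y • b i =
            dualBasisElem b i (contrL a (comul y)) • b i := fun i => by rw [mul_apply_contrL]
        simp only [h1]
        rw [sum_dualBasisElem_smul]
        conv_rhs => rw [← sum_dualBasisElem_smul b y]
        simp only [map_sum, map_smul]
    simp only [Q, mul_one, Finset.mul_sum]
    refine Eq.trans ?_ (hc.trans ?_)
    · refine Finset.sum_congr rfl fun i _ => ?_
      rw [← antipodePairing_contrL hl]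
      rfl
    · exact Finset.sum_congr rfl fun i _ => mul_assoc _ _ _
  have hQ1 : Q 1 ∈ J := J.sum_mem fun i _ => hJl _ _ (hq'J _)
  obtain ⟨N, hN⟩ := hJn _ hQ1
  rw [Submodule.eq_bot_iff]
  intro z hz
  have hz1 : z * Q 1 = z := by rw [← hQmul, hQ z hz]
  have hzn : ∀ n, z * Q 1 ^ n = z := fun n => by
    induction n with
    | zero => rw [pow_zero, mul_one]
    | succ n ih => rw [pow_succ, ← mul_assoc, ih, hz1]
  rw [← hzn N, hN, mul_zero]

/-- The transpose of the antipode is a surjective antihomomorphism, so it exchanges right and left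
integrals. -/
theorem eq_bot_of_isRightIntegral_dual {l : WithConv (H →ₗ[k] k)}
    (hl : ∀ c : WithConv (H →ₗ[k] k), l * c = c 1 • l) (hl1 : l 1 = 1)
    {J : Submodule k (WithConv (H →ₗ[k] k))} (hJl : ∀ a, ∀ x ∈ J, a * x ∈ J)
    (hJn : ∀ x ∈ J, IsNilpotent x) : J = ⊥ := by
  refine eq_bot_of_isLeftIntegral_dual (l := ant l) (fun c => ?_) ?_ hJl hJn
  · obtain ⟨c, rfl⟩ := ant_surjective k H c
    rw [← ant_mul, hl, map_smul, ant_apply, HopfAlgebra.antipode_one]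
  · rw [ant_apply, HopfAlgebra.antipode_one, hl1]

/-- If `a e = a(g) e` for a grouplike `g` with `e(g) = 1`, then nilpotent ideals of the dual
algebra vanish. -/
theorem eq_bot_of_forall_mul_eq_smul {g : H} (hg : IsGroupLikeElem k g)
    {e : WithConv (H →ₗ[k] k)} (heg : e g = 1) (he : ∀ a, a * e = a g • e)
    {J : Submodule k (WithConv (H →ₗ[k] k))} (hJl : ∀ a, ∀ x ∈ J, a * x ∈ J)
    (hJn : ∀ x ∈ J, IsNilpotent x) : J = ⊥ := by
  -- Translation by `g` is an algebra automorphism of the dual carrying the character `g` to the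
  -- character `1`, so it turns `e` into a normalised integral.
  refine eq_bot_of_isLeftIntegral_dual (l := translateLeft g e) (fun c => ?_) ?_ hJl hJn
  · conv_lhs => rw [← translateLeft_translateLeft_antipode hg c]
    rw [← translateLeft_mul hg, he, translateLeft_apply, hg.antipode_mul_cancel]
    rfl
  · rw [translateLeft_apply, mul_one, heg]

theorem eq_bot_of_forall_mul_eq_smul_right {g : H} (hg : IsGroupLikeElem k g)
    {e : WithConv (H →ₗ[k] k)} (heg : e g = 1) (he : ∀ a, e * a = a g • e)
    {J : Submodule k (WithConv (H →ₗ[k] k))} (hJl : ∀ a, ∀ x ∈ J, a * x ∈ J)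
    (hJn : ∀ x ∈ J, IsNilpotent x) : J = ⊥ := by
  refine eq_bot_of_isRightIntegral_dual (l := translateLeft g e) (fun c => ?_) ?_ hJl hJn
  · conv_lhs => rw [← translateLeft_translateLeft_antipode hg c]
    rw [← translateLeft_mul hg, he, translateLeft_apply, hg.antipode_mul_cancel]
    rfl
  · rw [translateLeft_apply, mul_one, heg]

end Maschke

end HopfCoradical

namespace HopfCoradical

open Coalgebra WithConv HopfAlgebra

/-! ### The three facts combined for a Hopf algebra -/

section Hopf

variable {k H : Type*} [Field k] [Ring H] [HopfAlgebra k H] {ι : Type*} {d : ι → ℕ}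
  {φ : WithConv (H →ₗ[k] k) →ₐ[k] Π i, Matrix (Fin (d i)) (Fin (d i)) k}

theorem rad_ne_bot (hcoss : ¬ IsCosemisimple k H) (hc : coradical k H = perp (rad φ)) :
    rad φ ≠ ⊥ := fun h => hcoss <| by
  rw [IsCosemisimple, hc, h, eq_top_iff]
  intro x _ a ha
  rw [(Submodule.mem_bot k).1 ha]
  rfl

variable [DecidableEq ι]

theorem mul_sub_smul_mem_rad {i : ι} {g : H}
    (hg : ∀ a : WithConv (H →ₗ[k] k), φ a i = algebraMap k _ (a g)) {e : WithConv (H →ₗ[k] k)}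
    (he : φ e = Pi.single i 1) (a : WithConv (H →ₗ[k] k)) :
    a * e - a g • e ∈ rad φ ∧ e * a - a g • e ∈ rad φ := by
  constructor <;> rw [mem_rad, map_sub, map_mul, map_smul, he] <;> funext l
  all_goals
    by_cases hl : l = i
    · subst hl
      simp [hg a, Algebra.algebraMap_eq_smul_one]
    · simp [hl]

theorem apply_eq_one_of_eq_single {i : ι} (hi : d i = 1) {g : H}
    (hg : ∀ a : WithConv (H →ₗ[k] k), φ a i = algebraMap k _ (a g)) {e : WithConv (H →ₗ[k] k)}
    (he : φ e = Pi.single i 1) : e g = 1 := by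
  have : Nonempty (Fin (d i)) := ⟨⟨0, by omega⟩⟩
  refine (algebraMap k (Matrix (Fin (d i)) (Fin (d i)) k)).injective ?_
  rw [← hg, he, Pi.single_eq_same, map_one]

variable [FiniteDimensional k H]

/-- `a * e` and `a g • e` differ by an element of `J`. If `J e = 0`, multiplying by the idempotent
`e` makes them equal, and Maschke's theorem forces `J = 0`; likewise on the other side. -/
theorem exists_rad_mul_ne_zero {N : ℕ} (hN : rad φ ^ N = ⊥) (h0 : rad φ ≠ ⊥) (i : ι)
    (e : WithConv (H →ₗ[k] k)) (hi : d i = 1) (he : IsIdempotentElem e)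
    (hφe : φ e = Pi.single i 1) :
    (∃ x ∈ rad φ, x * e ≠ 0) ∧ ∃ x ∈ rad φ, e * x ≠ 0 := by
  obtain ⟨g, hg, hφg⟩ := exists_isGroupLikeElem (φ := φ) i hi
  have heg := apply_eq_one_of_eq_single hi hφg hφe
  have hJl : ∀ a, ∀ x ∈ rad φ, a * x ∈ rad φ := fun a x hx => by
    rw [mem_rad, map_mul, mem_rad.1 hx, mul_zero]
  have hJn : ∀ x ∈ rad φ, IsNilpotent x := fun x hx =>
    ⟨N, by simpa [hN] using Submodule.pow_mem_pow (rad φ) hx N⟩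
  constructor
  · by_contra! h
    refine h0 (eq_bot_of_forall_mul_eq_smul hg heg (fun a => ?_) hJl hJn)
    have h1 := h _ (mul_sub_smul_mem_rad hφg hφe a).1
    rwa [sub_mul, smul_mul_assoc, mul_assoc, he.eq, sub_eq_zero] at h1
  · by_contra! h
    refine h0 (eq_bot_of_forall_mul_eq_smul_right hg heg (fun a => ?_) hJl hJn)
    have h1 := h _ (mul_sub_smul_mem_rad hφg hφe a).2
    rwa [mul_sub, mul_smul_comm, ← mul_assoc, he.eq, sub_eq_zero] at h1

variable [Fintype ι]

theorem links_of_not_isCosemisimple (hcoss : ¬ IsCosemisimple k H)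
    (hskew : NoNontrivialSkewPrimitives k H) (hd : ∀ i, 1 ≤ d i) (hφ : Function.Surjective φ)
    {N : ℕ} (hN : rad φ ^ N = ⊥) (g : ι) (hg : d g = 1) :
    (∃ C, 1 < d C ∧ Link φ 1 C g ∧ ∃ n D, 1 < n ∧ d D = d C ∧ Link φ n C D) ∧
      (∃ C, 1 < d C ∧ Link φ 1 g C) ∧ ∃ m h, 1 < m ∧ d h = 1 ∧ Link φ m g h := by
  obtain ⟨T, hT⟩ := exists_frobenius_form k H
  have h0 := rad_ne_bot hcoss (coradical_eq_perp_rad hd hφ hN)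
  exact links_of_frobenius hd hφ hN T hT
    (fun i e hi he hφe => (exists_rad_mul_ne_zero hN h0 i e hi he hφe).2)
    (fun i e hi he hφe => (exists_rad_mul_ne_zero hN h0 i e hi he hφe).1)
    (fun i j hi hj => not_link_of_noNontrivialSkewPrimitives hφ hskew hi hj) g hg

theorem exists_nondegenerate_isotypic (hcoss : ¬ IsCosemisimple k H)
    (hskew : NoNontrivialSkewPrimitives k H) (hd : ∀ i, 1 ≤ d i) (hφ : Function.Surjective φ)
    {N : ℕ} (hN : rad φ ^ N = ⊥) {π : H →ₗc[k] H} (hπ : IsCoradicalProjection π) {g : H}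
    (hg : IsGroupLikeElem k g) :
    ∃ C : Submodule k H, IsSimpleSubcoalgebra C ∧ 1 < Module.finrank k C ∧
      isotypicP π 1 C (Submodule.span k {g}) ≠ ⊥ ∧
      (∃ (n : ℕ) (D : Submodule k H), 1 < n ∧ IsSimpleSubcoalgebra D ∧
        Module.finrank k D = Module.finrank k C ∧ IsNondegenerateP π n C D) ∧
      (∃ (m : ℕ) (h : H), 1 < m ∧ IsGroupLikeElem k h ∧
        IsNondegenerateP π m (Submodule.span k {g}) (Submodule.span k {h})) := by
  have hc := coradical_eq_perp_rad hd hφ hN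
  obtain ⟨i, hi, hig⟩ := exists_block_of_isGroupLikeElem hφ hN hg
  obtain ⟨⟨C, hC1, hCl, n, D, hn, hD, hCD⟩, -, m, j, hm, hj, hij⟩ :=
    links_of_not_isCosemisimple hcoss hskew hd hφ hN i hi
  rw [← hig]
  refine ⟨blockCoalgebra φ C, isSimpleSubcoalgebra_blockCoalgebra hφ (hd C), ?_, ?_,
    ⟨n, blockCoalgebra φ D, hn, isSimpleSubcoalgebra_blockCoalgebra hφ (hd D), ?_,
      hCD.isNondegenerateP hπ hc hφ hd hn.le⟩, ?_⟩
  · rw [finrank_blockCoalgebra hφ]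
    exact Nat.one_lt_pow two_ne_zero hC1
  · intro h
    refine hCl.isNondegenerateP hπ hc hφ hd le_rfl ?_
    rw [h]
    exact bot_le
  · rw [finrank_blockCoalgebra hφ, finrank_blockCoalgebra hφ, hD]
  · obtain ⟨h, hh, hφh⟩ := exists_isGroupLikeElem (φ := φ) j hj
    have hjh : blockCoalgebra φ j = Submodule.span k {h} :=
      blockCoalgebra_eq_span hφ hj hh.ne_zero ?_
    · refine ⟨m, h, hm, hh, ?_⟩
      rw [← hjh]
      exact hij.isNondegenerateP hπ hc hφ hd hm.le
    · intro a ha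
      have : Nonempty (Fin (d j)) := ⟨⟨0, by omega⟩⟩
      exact (algebraMap k (Matrix (Fin (d j)) (Fin (d j)) k)).injective
        ((hφh a).symm.trans (ha.trans (map_zero _).symm))

end Hopf

end HopfCoradical

namespace HopfCoradical

open Coalgebra WithConv

/-! ### Comatrix coalgebras as representations of the dual algebra -/

section MatrixCoefficients

variable {k H : Type*} [Field k] [AddCommGroup H] [Module k H] [Coalgebra k H]

/-- A family of matrix coefficients. -/
structure IsComatrix (k : Type*) {H : Type*} [Field k] [AddCommGroup H] [Module k H]
    [Coalgebra k H] {m : ℕ} (c : Fin m → Fin m → H) : Prop where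
  comul_eq : ∀ p q, comul (R := k) (c p q) = ∑ l, c p l ⊗ₜ[k] c l q
  counit_eq : ∀ p q, counit (R := k) (c p q) = if p = q then 1 else 0

theorem Comatrix.isComatrix_e (m : ℕ) : IsComatrix k (Comatrix.e (k := k) (n := m)) :=
  ⟨Comatrix.comul_e, Comatrix.counit_e⟩

theorem isComatrix_of_isGroupLikeElem {g : H} (hg : IsGroupLikeElem k g) :
    IsComatrix k fun _ _ : Fin 1 => g :=
  ⟨fun _ _ => by simpa using hg.comul_eq_tmul_self, fun p q => by
    rw [if_pos (Subsingleton.elim p q), hg.counit_eq_one]⟩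

theorem IsComatrix.map {H' : Type*} [AddCommGroup H'] [Module k H'] [Coalgebra k H'] {m : ℕ}
    {c : Fin m → Fin m → H} (hc : IsComatrix k c) (f : H →ₗc[k] H') :
    IsComatrix k fun p q => f (c p q) :=
  ⟨fun p q => by rw [← CoalgHomClass.map_comp_comul_apply, hc.comul_eq, map_sum]; rfl,
    fun p q => by rw [CoalgHomClass.counit_comp_apply, hc.counit_eq]⟩

/-- The representation of the dual algebra given by a family of matrix coefficients. -/
noncomputable def IsComatrix.rep {m : ℕ} {c : Fin m → Fin m → H} (hc : IsComatrix k c) :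
    WithConv (H →ₗ[k] k) →ₐ[k] Matrix (Fin m) (Fin m) k :=
  AlgHom.ofLinearMap
    { toFun := fun a => Matrix.of fun p q => a (c p q)
      map_add' := fun _ _ => rfl
      map_smul' := fun _ _ => rfl }
    (Matrix.ext fun p q => (hc.counit_eq p q).trans Matrix.one_apply.symm)
    fun a b => Matrix.ext fun p q => by
      change (a * b) (c p q) = _
      rw [mul_apply_contrL, hc.comul_eq, map_sum, map_sum]
      simp only [contrL_tmul, map_smul, smul_eq_mul]
      exact (Matrix.mul_apply (M := Matrix.of fun p q => a (c p q))
        (N := Matrix.of fun p q => b (c p q))).symm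

theorem IsComatrix.rep_apply {m : ℕ} {c : Fin m → Fin m → H} (hc : IsComatrix k c)
    (a : WithConv (H →ₗ[k] k)) (p q : Fin m) : hc.rep a p q = a (c p q) := rfl

theorem IsComatrix.rep_surjective {m : ℕ} {c : Fin m → Fin m → H} (hc : IsComatrix k c)
    (hli : LinearIndependent k fun p : Fin m × Fin m => c p.1 p.2) :
    Function.Surjective hc.rep := by
  intro M
  obtain ⟨r, hr⟩ := LinearMap.exists_leftInverse_of_injective _ (LinearMap.ker_eq_bot.2 hli)
  refine ⟨toConv (Finsupp.linearCombination k (fun p : Fin m × Fin m => M p.1 p.2) ∘ₗ r),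
    Matrix.ext fun p q => ?_⟩
  have h1 := LinearMap.congr_fun hr (Finsupp.single (p, q) 1)
  rw [LinearMap.comp_apply, Finsupp.linearCombination_single, one_smul] at h1
  change Finsupp.linearCombination k (fun p : Fin m × Fin m => M p.1 p.2) (r (c p q)) = M p q
  rw [h1]
  simp

/-- A block of the dual algebra which does not vanish on a simple comatrix coalgebra has the size of
that coalgebra. -/
theorem IsComatrix.size_eq {ι : Type*} {d : ι → ℕ} [DecidableEq ι]
    {φ : WithConv (H →ₗ[k] k) →ₐ[k] Π i, Matrix (Fin (d i)) (Fin (d i)) k}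
    (hφ : Function.Surjective φ) {N : ℕ} (hN : rad φ ^ N = ⊥) {m : ℕ} {c : Fin m → Fin m → H}
    (hc : IsComatrix k c) (hli : LinearIndependent k fun p : Fin m × Fin m => c p.1 p.2) {i : ι}
    {e : WithConv (H →ₗ[k] k)} (he : SupportedAt φ i e) {p q : Fin m} (h0 : e (c p q) ≠ 0) :
    d i = m :=
  size_eq_of_supportedAt hφ hN (hc.rep_surjective hli) he fun h => h0 <| by
    rw [← hc.rep_apply, h]
    rfl

end MatrixCoefficients

section Inclusions

variable (k A B : Type*) [Field k] [AddCommGroup A] [Module k A] [Coalgebra k A]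
  [AddCommGroup B] [Module k B] [Coalgebra k B]

/-- The inclusion of the first summand of a direct sum of coalgebras. -/
noncomputable def coalgInl : A →ₗc[k] A × B where
  toLinearMap := LinearMap.inl k A B
  counit_comp := Prod.counit_comp_inl k A B
  map_comp_comul := (Prod.comul_comp_inl k A B).symm

/-- The inclusion of the second summand of a direct sum of coalgebras. -/
noncomputable def coalgInr : B →ₗc[k] A × B where
  toLinearMap := LinearMap.inr k A B
  counit_comp := Prod.counit_comp_inr k A B
  map_comp_comul := (Prod.comul_comp_inr k A B).symm

/-- The inclusion of a summand of a finite direct sum of coalgebras. -/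
noncomputable def coalgSingle {κ : Type*} [Fintype κ] [DecidableEq κ] (C : κ → Type*)
    [∀ i, AddCommGroup (C i)] [∀ i, Module k (C i)] [∀ i, Coalgebra k (C i)] (i : κ) :
    C i →ₗc[k] Π i, C i where
  toLinearMap := LinearMap.single k C i
  counit_comp := Pi.counit_comp_single i
  map_comp_comul := (Pi.comul_comp_single i).symm

end Inclusions

/-! ### Reading block sizes off the given coradical -/

section Cosemisimple

variable {k H : Type*} [Field k] [AddCommGroup H] [Module k H] [Coalgebra k H]
  {G : Type*} {n t : ℕ} {d' : Fin t → ℕ}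
  {Φ : (MonoidAlgebra k G × Comatrix k n × ((i : Fin t) → Comatrix k (d' i))) →ₗc[k] H}

theorem isGroupLikeElem_apply_single (g : G) :
    IsGroupLikeElem k (Φ (MonoidAlgebra.single g 1, 0)) :=
  (MonoidAlgebra.isGroupLikeElem_single_one g).map (Φ.comp (coalgInl k (MonoidAlgebra k G) _))

variable {ι : Type*} {d : ι → ℕ}
    {φ : WithConv (H →ₗ[k] k) →ₐ[k] Π i, Matrix (Fin (d i)) (Fin (d i)) k}

theorem size_eq_one_of_isGroupLikeElem [DecidableEq ι] (hφ : Function.Surjective φ) {N : ℕ}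
    (hN : rad φ ^ N = ⊥) {g : H} (hg : IsGroupLikeElem k g) {i : ι}
    {e : WithConv (H →ₗ[k] k)} (he : SupportedAt φ i e) (h0 : e g ≠ 0) : d i = 1 :=
  (isComatrix_of_isGroupLikeElem hg).size_eq hφ hN
    (LinearIndependent.of_subsingleton (0, 0) hg.ne_zero) he
    (p := (0 : Fin 1)) (q := (0 : Fin 1)) h0

theorem comatrix_size_eq [DecidableEq ι] (hφ : Function.Surjective φ) {N : ℕ}
    (hN : rad φ ^ N = ⊥) {m : ℕ} {f : Comatrix k m →ₗc[k] H} (hf : Function.Injective f) {i : ι}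
    {e : WithConv (H →ₗ[k] k)} (he : SupportedAt φ i e) (hne : d i ≠ m) :
    e.ofConv ∘ₗ f.toLinearMap = 0 := by
  refine (Comatrix.basis k m).ext fun p => ?_
  by_contra h
  exact hne (((Comatrix.isComatrix_e m).map f).size_eq hφ hN
    ((Comatrix.basis k m).linearIndependent.map' f.toLinearMap (LinearMap.ker_eq_bot.2 hf))
    he (p := p.1) (q := p.2) h)

/-- A lift of the identity of block `i` is nonzero on the coradical, hence on some summand of the
given decomposition; only a summand of the size of the block can detect it. -/
theorem block_size_of_cosemisimple [FiniteDimensional k H] [DecidableEq ι]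
    (hd : ∀ i, 1 ≤ d i) (hφ : Function.Surjective φ) {N : ℕ} (hN : rad φ ^ N = ⊥)
    (hΦ : Function.Injective Φ) (hc : perp (rad φ) ≤ LinearMap.range Φ.toLinearMap)
    (hd' : ∀ i, n ≤ d' i) (i : ι) : d i = 1 ∨ n ≤ d i := by
  obtain ⟨e, he⟩ := hφ (Pi.single i 1)
  have hs := supportedAt_of_eq_single he
  have he0 : e ∉ rad φ := fun h => by
    rw [mem_rad, he] at h
    have : Nonempty (Fin (d i)) := ⟨⟨0, hd i⟩⟩
    exact one_ne_zero (α := Matrix (Fin (d i)) (Fin (d i)) k) (by simpa using congrFun h i)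
  obtain ⟨x, hx, hex⟩ := exists_eval_ne_zero he0
  obtain ⟨y, rfl⟩ := hc hx
  by_contra! hne
  refine hex (LinearMap.congr_fun (f := e.ofConv ∘ₗ Φ.toLinearMap) (g := 0)
    (LinearMap.prod_ext ?_ (LinearMap.prod_ext ?_ ?_)) y)
  · refine MonoidAlgebra.lhom_ext' fun g => LinearMap.ext_ring ?_
    by_contra h
    exact hne.1 (size_eq_one_of_isGroupLikeElem hφ hN
      (isGroupLikeElem_apply_single (Φ := Φ) g) hs h)
  · exact comatrix_size_eq hφ hN (f := Φ.comp ((coalgInr k _ _).comp (coalgInl k _ _)))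
      (hΦ.comp (LinearMap.inr_injective.comp LinearMap.inl_injective)) hs hne.2.ne
  · exact LinearMap.pi_ext' fun j => comatrix_size_eq hφ hN
      (f := Φ.comp ((coalgInr k _ _).comp ((coalgInr k _ _).comp
        (coalgSingle k (fun i => Comatrix k (d' i)) j))))
      (hΦ.comp (LinearMap.inr_injective.comp (LinearMap.inr_injective.comp
        (Pi.single_injective (M := fun i => Comatrix k (d' i)) j)))) hs (hne.2.trans_le (hd' j)).ne

/-- Two grouplikes on the same line agree, by the counit, so distinct elements of `G` occupy
distinct blocks. An inequality suffices for the bound. -/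
theorem card_le_card_block [FiniteDimensional k H] [Fintype ι] [DecidableEq ι]
    (hφ : Function.Surjective φ) {N : ℕ} (hN : rad φ ^ N = ⊥) (hΦ : Function.Injective Φ) :
    Nat.card G ≤ Fintype.card {i // d i = 1} := by
  choose i hi hig using fun g : G =>
    exists_block_of_isGroupLikeElem hφ hN (isGroupLikeElem_apply_single (Φ := Φ) g)
  rw [← Nat.card_eq_fintype_card]
  refine Nat.card_le_card_of_injective (fun g => (⟨i g, hi g⟩ : {i // d i = 1})) fun g g' h => ?_
  have h1 : i g = i g' := congrArg Subtype.val h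
  have h2 : Φ (MonoidAlgebra.single g 1, 0) ∈
      Submodule.span k {Φ (MonoidAlgebra.single g' 1, 0)} := by
    rw [← hig g', ← h1, hig g]
    exact Submodule.mem_span_singleton_self _
  obtain ⟨r, hr⟩ := Submodule.mem_span_singleton.1 h2
  have h3 := congrArg (counit (R := k)) hr
  rw [map_smul, (isGroupLikeElem_apply_single g').counit_eq_one,
    (isGroupLikeElem_apply_single g).counit_eq_one, smul_eq_mul, mul_one] at h3
  rw [h3, one_smul] at hr
  have h4 := congrArg Prod.fst (hΦ hr)
  exact (MonoidAlgebra.single_left_injective one_ne_zero h4).symm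

theorem finrank_coradical [FiniteDimensional k H] [Fintype ι] [DecidableEq ι]
    (hd : ∀ i, 1 ≤ d i) (hφ : Function.Surjective φ) {N : ℕ} (hN : rad φ ^ N = ⊥) :
    Module.finrank k (coradical k H) = ∑ i, d i ^ 2 := by
  have h1 := finrank_add_finrank_perp (rad φ)
  have h2 := finrank_rad_add hφ
  rw [finrank_withConv_dual] at h2
  rw [coradical_eq_perp_rad hd hφ hN]
  omega

end Cosemisimple

end HopfCoradical

open HopfCoradical in
theorem mainTheorem7 {k : Type*} [Field k] [IsAlgClosed k] [CharZero k]
    {H : Type*} [Ring H] [HopfAlgebra k H] [FiniteDimensional k H]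
    (hcoss : ¬ IsCosemisimple k H) (hskew : NoNontrivialSkewPrimitives k H) :
    (∀ π : H →ₗc[k] H, IsCoradicalProjection π →
      ∀ g : H, IsGroupLikeElem k g →
        ∃ C : Submodule k H, IsSimpleSubcoalgebra C ∧ 1 < Module.finrank k C ∧
          isotypicP π 1 C (Submodule.span k {g}) ≠ ⊥ ∧
          (∃ (n : ℕ) (D : Submodule k H), 1 < n ∧ IsSimpleSubcoalgebra D ∧
            Module.finrank k D = Module.finrank k C ∧ IsNondegenerateP π n C D) ∧
          (∃ (m : ℕ) (h : H), 1 < m ∧ IsGroupLikeElem k h ∧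
            IsNondegenerateP π m (Submodule.span k {g}) (Submodule.span k {h}))) ∧
    (∀ (G : Type*) [Group G] (n t : ℕ) (d : Fin t → ℕ),
      2 ≤ n → (∀ i, n ≤ d i) → Monotone d →
      ∀ φ : (MonoidAlgebra k G × Comatrix k n × ((i : Fin t) → Comatrix k (d i))) →ₗc[k] H,
        Function.Injective φ →
        LinearMap.range φ.toLinearMap = coradical k H →
        Module.finrank k (coradical k H) + (2 * n + 1) * Nat.card G + n ^ 2 ≤
          Module.finrank k H) := by
  obtain ⟨r, d, φ, hd, hφ, N, hN⟩ := exists_wedderburn k (WithConv (H →ₗ[k] k))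
  refine ⟨fun π hπ g hg => exists_nondegenerate_isotypic hcoss hskew hd hφ hN hπ hg,
    fun G _ n t d' _ hd' _ Φ hΦ hr => ?_⟩
  -- The unit of `H` supplies the one grouplike block needed for the `n ^ 2` term.
  obtain ⟨g₀, hg₀, -⟩ := exists_block_of_isGroupLikeElem hφ hN
    (IsGroupLikeElem.one (R := k) (A := H))
  have h := finrank_ge_of_links hφ hN
    (fun C hC => (block_size_of_cosemisimple hd hφ hN hΦ
      (by rw [hr, coradical_eq_perp_rad hd hφ hN]) hd' C).resolve_left hC.ne')
    (links_of_not_isCosemisimple hcoss hskew hd hφ hN) g₀ hg₀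
  rw [finrank_withConv_dual] at h
  have h2 := Nat.mul_le_mul_left (2 * n + 1) (card_le_card_block hφ hN hΦ)
  rw [finrank_coradical hd hφ hN]
  omega
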